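/- There is an absolute constant $c>0$ such that the following holds for all integers $n\ge 2$ and $m\ge 0$, all $A\in\mathbb{R}^{m\times n}$ and all $\mathbf{b}\in\mathbb{R}^m$. Suppose that $P=\{\mathbf{x}\in\mathbb{R}^n: A\mathbf{x}\le \mathbf{b}\}$ is bounded, full-dimensional (its affine hull is $\mathbb{R}^n$) and simple (every vertex of $P$ lies on exactly $n$ facets of $P$). For a vertex $\mathbf{v}$ of $P$ let $N(\mathbf{v})=\{\mathbf{c}\in\mathbb{R}^n: \mathbf{c}^{\intercal}\mathbf{x}\le \mathbf{c}^{\intercal}\mathbf{v}\text{ for all }\mathbf{x}\in P\}$ be its normal cone, and let $R(\mathbf{v})$ be the set of unit vectors that generate an extreme ray of $N(\mathbf{v})$. Let $$\delta=\min\{\,d(\mathbf{u},\operatorname{span}(R(\mathbf{v})\setminus\{\mathbf{u}\})) : \mathbf{v}\text{ a vertex of }P,\ \mathbf{u}\in R(\mathbf{v})\,\},$$ that is, the minimal Euclidean distance from a unit ray of a normal cone to the hyperplane spanned by the other rays of that cone. Let $(U,V)$ be uniformly distributed (with respect to the rotation invariant probability measure) on the pairs of orthonormal vectors of $\mathbb{R}^n$,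 and let $s$ be the number of vertices of the shadow $\pi(P)\subseteq\mathbb{R}^2$, where $\pi(\mathbf{x})=(U^{\intercal}\mathbf{x},V^{\intercal}\mathbf{x})$. Then $s$ is integrable and $$\mathbb{E}[s]\le c\,\frac{n^2}{\delta}.$$ -/

import Mathlib

open MeasureTheory ProbabilityTheory
open scoped RealInnerProductSpace

noncomputable section

/-- The polyhedron `{x : A x ≤ b}` in `ℝⁿ`. -/
def polyhedron {m n : ℕ} (A : Matrix (Fin m) (Fin n) ℝ) (b : Fin m → ℝ) :
    Set (EuclideanSpace ℝ (Fin n)) :=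
  {x | ∀ i, A.mulVec x.ofLp i ≤ b i}

/-- The vertices of a polyhedron. -/
def vertices {E : Type*} [AddCommGroup E] [Module ℝ E] (P : Set E) : Set E :=
  P.extremePoints ℝ

/-- `F` is a facet of the full-dimensional polyhedron `P ⊆ ℝⁿ`: a face (the set of maximizers over
`P` of a linear functional) of dimension `n - 1`. -/
def IsFacet {n : ℕ} (P F : Set (EuclideanSpace ℝ (Fin n))) : Prop :=
  IsExposed ℝ P F ∧ Module.finrank ℝ (vectorSpan ℝ F) + 1 = n

/-- A full-dimensional polytope in `ℝⁿ` is simple if each of its vertices lies on exactly `n` of its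
facets. -/
def IsSimplePolytope {n : ℕ} (P : Set (EuclideanSpace ℝ (Fin n))) : Prop :=
  ∀ v ∈ vertices P, {F | IsFacet P F ∧ v ∈ F}.encard = n

/-- The normal cone of `P` at `v`: all objectives that are maximized over `P` at `v`. -/
def normalCone {n : ℕ} (P : Set (EuclideanSpace ℝ (Fin n))) (v : EuclideanSpace ℝ (Fin n)) :
    Set (EuclideanSpace ℝ (Fin n)) :=
  {c | ∀ x ∈ P, ⟪c, x⟫ ≤ ⟪c, v⟫}

/-- The unit length rays of a cone `K`: the unit vectors `u` that generate an extreme ray of `K`. -/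
def unitRays {n : ℕ} (K : Set (EuclideanSpace ℝ (Fin n))) : Set (EuclideanSpace ℝ (Fin n)) :=
  {u | ‖u‖ = 1 ∧ IsExtreme ℝ K {y | ∃ t : ℝ, 0 ≤ t ∧ y = t • u}}

/-- All distances from a unit ray `u` of the normal cone at a vertex `v` of `P` to the linear span
of the other rays of that cone. -/
def rayDistances {n : ℕ} (P : Set (EuclideanSpace ℝ (Fin n))) : Set ℝ :=
  {d | ∃ v ∈ vertices P, ∃ u ∈ unitRays (normalCone P v),
    d = Metric.infDist u
      (Submodule.span ℝ (unitRays (normalCone P v) \ {u}) : Set (EuclideanSpace ℝ (Fin n)))}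

/-- The parameter `δ` of `P`, the minimum of `rayDistances P`
(which is a finite nonempty set for a simple polytope). -/
def coneDelta {n : ℕ} (P : Set (EuclideanSpace ℝ (Fin n))) : ℝ :=
  sInf (rayDistances P)

/-- The shadow of `P` under `x ↦ (Uᵀ x, Vᵀ x)`, where `p = (U, V)`. -/
def shadow {n : ℕ} (P : Set (EuclideanSpace ℝ (Fin n)))
    (p : EuclideanSpace ℝ (Fin n) × EuclideanSpace ℝ (Fin n)) : Set (ℝ × ℝ) :=
  (fun x => (⟪p.1, x⟫, ⟪p.2, x⟫)) '' P

/-- The number of vertices of the shadow of `P` determined by `p = (U, V)`. -/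
def shadowSize {n : ℕ} (P : Set (EuclideanSpace ℝ (Fin n)))
    (p : EuclideanSpace ℝ (Fin n) × EuclideanSpace ℝ (Fin n)) : ℕ :=
  (vertices (shadow P p)).ncard

/-- Gram–Schmidt orthonormalization of a pair of vectors. -/
def orthonormalize {n : ℕ} (p : EuclideanSpace ℝ (Fin n) × EuclideanSpace ℝ (Fin n)) :
    EuclideanSpace ℝ (Fin n) × EuclideanSpace ℝ (Fin n) :=
  let U := ‖p.1‖⁻¹ • p.1
  let W := p.2 - ⟪U, p.2⟫ • U
  (U, ‖W‖⁻¹ • W)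

/-- The uniform distribution on the pairs `(U, V)` of orthonormal vectors in `ℝⁿ` (`n ≥ 2`), that is,
the rotation invariant probability measure on them: the law of the orthonormalization of a
pair of independent standard Gaussian vectors. -/
def uniformFrame (n : ℕ) : Measure (EuclideanSpace ℝ (Fin n) × EuclideanSpace ℝ (Fin n)) :=
  ((stdGaussian (EuclideanSpace ℝ (Fin n))).prod (stdGaussian (EuclideanSpace ℝ (Fin n)))).map
    orthonormalize

theorem measurable_orthonormalize (n : ℕ) : Measurable (orthonormalize (n := n)) := by
  unfold orthonormalize
  fun_prop

instance isProbabilityMeasure_uniformFrame (n : ℕ) : IsProbabilityMeasure (uniformFrame n) :=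
  Measure.isProbabilityMeasure_map (measurable_orthonormalize n).aemeasurable

theorem orthonormalize_map {n : ℕ}
    (g : EuclideanSpace ℝ (Fin n) ≃ₗᵢ[ℝ] EuclideanSpace ℝ (Fin n))
    (p : EuclideanSpace ℝ (Fin n) × EuclideanSpace ℝ (Fin n)) :
    orthonormalize (Prod.map g g p) = Prod.map g g (orthonormalize p) := by
  simp only [orthonormalize, Prod.map, LinearIsometryEquiv.norm_map, ← map_smul,
    LinearIsometryEquiv.inner_map_map, ← map_sub]

/-- `uniformFrame n` is rotation invariant. -/
theorem uniformFrame_map {n : ℕ}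
    (g : EuclideanSpace ℝ (Fin n) ≃ₗᵢ[ℝ] EuclideanSpace ℝ (Fin n)) :
    (uniformFrame n).map (Prod.map g g) = uniformFrame n := by
  have hg : Measurable g := g.continuous.measurable
  have h1 : (orthonormalize (n := n)) ∘ Prod.map g g = Prod.map g g ∘ orthonormalize :=
    funext (orthonormalize_map g)
  unfold uniformFrame
  rw [Measure.map_map (hg.prodMap hg) (measurable_orthonormalize n), ← h1,
    ← Measure.map_map (measurable_orthonormalize n) (hg.prodMap hg),
    ← Measure.map_prod_map _ _ hg hg, stdGaussian_map]

/-- If the pair is linearly independent, its orthonormalization is orthonormal. -/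
theorem orthonormalize_orthonormal {n : ℕ} (x y : EuclideanSpace ℝ (Fin n))
    (h : LinearIndependent ℝ ![x, y]) :
    ‖(orthonormalize (x, y)).1‖ = 1 ∧ ‖(orthonormalize (x, y)).2‖ = 1 ∧
      ⟪(orthonormalize (x, y)).1, (orthonormalize (x, y)).2⟫ = 0 := by
  have hx : x ≠ 0 := h.ne_zero 0
  have hU : ‖‖x‖⁻¹ • x‖ = 1 := by
    rw [norm_smul, norm_inv, norm_norm, inv_mul_cancel₀ (norm_ne_zero_iff.mpr hx)]
  have hW : y - ⟪‖x‖⁻¹ • x, y⟫ • ‖x‖⁻¹ • x ≠ 0 := by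
    intro h0
    rw [LinearIndependent.pair_iff] at h
    have := (h (-(⟪‖x‖⁻¹ • x, y⟫ * ‖x‖⁻¹)) 1 (by rw [← h0, smul_smul]; module)).2
    exact one_ne_zero this
  refine ⟨hU, ?_, ?_⟩
  · simp only [orthonormalize]
    rw [norm_smul, norm_inv, norm_norm, inv_mul_cancel₀ (norm_ne_zero_iff.mpr hW)]
  · simp only [orthonormalize]
    rw [inner_smul_right, inner_sub_right, inner_smul_right, real_inner_self_eq_norm_sq, hU]
    simp


theorem stdGaussian_hyperplane {n : ℕ} (z : EuclideanSpace ℝ (Fin n)) (hz : z ≠ 0) :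
    stdGaussian (EuclideanSpace ℝ (Fin n)) {y | ⟪z, y⟫ = 0} = 0 := by
  have h := IsGaussian.map_eq_gaussianReal (μ := stdGaussian (EuclideanSpace ℝ (Fin n)))
    (innerSL ℝ z)
  rw [variance_dual_stdGaussian] at h
  have hv : (‖innerSL ℝ z‖ ^ 2).toNNReal ≠ 0 := by
    rw [innerSL_apply_norm]
    have : 0 < ‖z‖ ^ 2 := by positivity
    simpa using hz
  have := nullSingletonClass_gaussianReal (μ := (stdGaussian (EuclideanSpace ℝ (Fin n)))[innerSL ℝ z]) hv
  have h2 : (stdGaussian (EuclideanSpace ℝ (Fin n))).map (innerSL ℝ z) {0} = 0 := by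
    rw [h]; exact measure_singleton 0
  rwa [Measure.map_apply (by fun_prop) (measurableSet_singleton 0)] at h2

/-- For `n ≥ 2`, `uniformFrame n` is concentrated on the orthonormal pairs. -/
theorem uniformFrame_orthonormal {n : ℕ} (hn : 2 ≤ n) :
    ∀ᵐ p ∂(uniformFrame n), ‖p.1‖ = 1 ∧ ‖p.2‖ = 1 ∧ ⟪p.1, p.2⟫ = 0 := by
  have hs : MeasurableSet {p : EuclideanSpace ℝ (Fin n) × EuclideanSpace ℝ (Fin n) |
      ‖p.1‖ = 1 ∧ ‖p.2‖ = 1 ∧ ⟪p.1, p.2⟫ = 0} := by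
    refine (measurableSet_eq_fun (by fun_prop) (by fun_prop)).inter
      ((measurableSet_eq_fun (by fun_prop) (by fun_prop)).inter
        (measurableSet_eq_fun (by fun_prop) (by fun_prop)))
  unfold uniformFrame
  rw [ae_map_iff (measurable_orthonormalize n).aemeasurable hs]
  refine (Measure.ae_prod_iff_ae_ae (measurable_orthonormalize n hs)).2 ?_
  have h0 : ∀ᵐ x ∂(stdGaussian (EuclideanSpace ℝ (Fin n))), x ≠ 0 := by
    have hz : EuclideanSpace.single (⟨0, by omega⟩ : Fin n) (1 : ℝ) ≠ 0 := by simp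
    refine measure_mono_null ?_ (stdGaussian_hyperplane _ hz)
    intro x hx
    simp at hx
    simp [hx]
  filter_upwards [h0] with x hx
  obtain ⟨z, hz, hzx⟩ : ∃ z : EuclideanSpace ℝ (Fin n), z ≠ 0 ∧ ⟪z, x⟫ = 0 := by
    have hne : (Submodule.span ℝ {x})ᗮ ≠ ⊥ := by
      intro h
      have h1 := Submodule.finrank_add_finrank_orthogonal (Submodule.span ℝ {x})
      rw [h, finrank_span_singleton hx, finrank_bot, finrank_euclideanSpace_fin] at h1
      omega
    obtain ⟨z, hz, hz0⟩ := Submodule.exists_mem_ne_zero_of_ne_bot hne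
    exact ⟨z, hz0, (Submodule.mem_orthogonal_singleton_iff_inner_left).1 hz⟩
  have h3 : ∀ᵐ y ∂(stdGaussian (EuclideanSpace ℝ (Fin n))), ⟪z, y⟫ ≠ 0 := by
    refine measure_mono_null ?_ (stdGaussian_hyperplane z hz)
    intro y hy
    simpa using hy
  filter_upwards [h3] with y hy
  refine orthonormalize_orthonormal x y ?_
  rw [LinearIndependent.pair_iff]
  intro s t h
  have ht : t = 0 := by
    have := congrArg (fun w => ⟪z, w⟫) h
    simpa [inner_add_right, inner_smul_right, hzx, hy] using this
  subst ht
  simpa [hx] using h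

end

/-!
Only vectors `c` of the random plane `W = span {U, V}` matter for the shadow: a vertex `v` of `P`
projects to a vertex of the shadow if and only if some `c ∈ W` is maximized over the vertices of `P`
at `v` alone (`vertices_shadow_eq`; this holds almost surely, namely if the vertices have distinct
projections). So `s` is almost surely a finite sum of indicators of open events, one for each vertex,
and it remains to bound the probabilities of these events.

Simplicity makes each normal cone `N(v)` simplicial (`exists_basis_normalCone`): it is closed and
pointed, hence generated by its unit rays; every unit ray belongs to a facet of `P` through `v`,
different rays to different facets, so there are at most `n` of them; and they span the space because
`v` is a vertex. If the event for `v` occurs, the plane `W` contains a nonzero vector of `N(v)`, but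
no half-plane of `W` lies in `N(v)`, and so `W` meets one of the `n` facets of the cone `N(v)` in a
nonzero vector (`exists_facet_of_plane`).

For such a facet `S` with unit normal `z`, take `U, V` to be the orthonormalization of independent
Gaussian vectors `X, Y`. The line `W ∩ z^⊥` is spanned by `⟪z, Y⟫ • X - ⟪z, X⟫ • Y`, and given
`⟪z, X⟫` and `⟪z, Y⟫` this is a multiple of a standard Gaussian vector of `z^⊥`. So each of its two
directions lies in `S` with a probability equal to the Gaussian measure of `S` in `z^⊥`
(`stdGaussian_prod_plane_inter_hyperplane_mem_cone_le`). On the other hand, the remaining ray `r` of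
`N(v)` has distance `⟪z, r⟫ ≥ δ` from `z^⊥`, so the sections of `N(v)` by hyperplanes parallel to
`z^⊥` at height at most `⟪z, r⟫ / n` contain translates of `S` by vectors of length at most `1 / n`.
Translating a cone by so little costs only a constant factor of its Gaussian measure
(`stdGaussian_cone_le_translate`), and hence the measure of `S` is at most `O(n / δ)` times that of
`N(v)` (`stdGaussian_facet_le_cone`).

The sum over the `n` facets of each of the cones is `O(n² / δ)` times the total Gaussian measure of
the normal cones, which is at most `1` because different normal cones overlap in null sets
(`sum_stdGaussian_normalCone_le_one`).
-/

/-! ### Gaussian measure of cones -/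

section Gaussian

variable {V : Type*} [NormedAddCommGroup V] [InnerProductSpace ℝ V] [FiniteDimensional ℝ V]
  [MeasurableSpace V] [BorelSpace V]

theorem integrable_exp_neg_norm_sq_div_two :
    Integrable (fun x : V => Real.exp (-‖x‖ ^ 2 / 2)) := by
  have h := (GaussianFourier.integrable_cexp_neg_mul_sq_norm_add (V := V) (b := (1 / 2 : ℂ))
    (by norm_num) 0 0).norm
  refine h.congr (Filter.Eventually.of_forall fun x => ?_)
  simp only [Complex.norm_exp]
  congr 1
  simp [← Complex.ofReal_pow]
  ring

/-- Both measures have the same characteristic function. -/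
theorem stdGaussian_eq_withDensity :
    stdGaussian V = (volume : Measure V).withDensity (fun x => ENNReal.ofReal
      (((2 * Real.pi) ^ (Module.finrank ℝ V / 2 : ℝ))⁻¹ * Real.exp (-‖x‖ ^ 2 / 2))) := by
  set c : ℝ := ((2 * Real.pi) ^ (Module.finrank ℝ V / 2 : ℝ))⁻¹ with hc
  have hc0 : 0 ≤ c := by positivity
  have hint : Integrable (fun x : V => c * Real.exp (-‖x‖ ^ 2 / 2)) :=
    integrable_exp_neg_norm_sq_div_two.const_mul c
  have : IsFiniteMeasure ((volume : Measure V).withDensity (fun x => ENNReal.ofReal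
      (c * Real.exp (-‖x‖ ^ 2 / 2)))) := isFiniteMeasure_withDensity_ofReal hint.2
  apply Measure.ext_of_charFun
  ext t
  rw [charFun_stdGaussian, charFun_apply,
    integral_withDensity_eq_integral_toReal_smul (by fun_prop) (by simp)]
  have h := GaussianFourier.integral_cexp_neg_mul_sq_norm_add (V := V) (b := (1 / 2 : ℂ))
    (by norm_num) Complex.I t
  have h2 : ∀ x : V, (ENNReal.ofReal (c * Real.exp (-‖x‖ ^ 2 / 2))).toReal •
      Complex.exp (⟪x, t⟫ * Complex.I) =
      (c : ℂ) * Complex.exp (-(1 / 2 : ℂ) * ‖x‖ ^ 2 + Complex.I * ⟪t, x⟫) := by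
    intro x
    rw [ENNReal.toReal_ofReal (by positivity), Complex.real_smul, Complex.exp_add,
      real_inner_comm x t]
    push_cast
    rw [mul_assoc, mul_comm Complex.I]
    congr 3
    ring
  simp_rw [h2, integral_const_mul]
  rw [h, ← mul_assoc]
  have h3 : (c : ℂ) * ((Real.pi : ℂ) / (1 / 2)) ^ (Module.finrank ℝ V / 2 : ℂ) = 1 := by
    have h4 : ((Real.pi : ℂ) / (1 / 2)) = ((2 * Real.pi : ℝ) : ℂ) := by push_cast; ring
    have h5 : (Module.finrank ℝ V / 2 : ℂ) = ((Module.finrank ℝ V / 2 : ℝ) : ℂ) := by push_cast; rfl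
    rw [h4, h5, ← Complex.ofReal_cpow (by positivity), ← Complex.ofReal_mul, hc,
      inv_mul_cancel₀ (by positivity)]
    simp
  rw [h3, one_mul]
  congr 1
  simp
  ring

/-- A Gaussian cone does not lose more than a constant factor of its measure when it is translated
by a vector of length `O(1 / √dim)`: the change of variables `y ↦ l • y + w` with
`l² = (1 + 1 / (dim + 1))⁻¹` maps the cone to its translate, and the loss in the density caused by
the shift is made up for by the contraction. -/
theorem stdGaussian_cone_le_translate {F : Set V} (hF : MeasurableSet F)
    (hcone : ∀ t : ℝ, 0 < t → ∀ x ∈ F, t • x ∈ F) {w : V}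
    (hw : ((Module.finrank ℝ V : ℝ) + 2) * ‖w‖ ^ 2 ≤ 1) :
    stdGaussian V F ≤ ENNReal.ofReal (Real.exp 1) * stdGaussian V {y | y - w ∈ F} := by
  set k : ℕ := Module.finrank ℝ V with hk
  set e : ℝ := 1 / ((k : ℝ) + 1) with he
  have he0 : 0 < e := by positivity
  set l : ℝ := Real.sqrt ((1 + e)⁻¹) with hl
  have hl0 : 0 < l := Real.sqrt_pos.2 (by positivity)
  have hl2 : l ^ 2 = (1 + e)⁻¹ := Real.sq_sqrt (by positivity)
  set c : ℝ := ((2 * Real.pi) ^ ((k : ℝ) / 2))⁻¹ with hc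
  have hc0 : 0 ≤ c := by positivity
  set f : V → ENNReal := fun x => ENNReal.ofReal (c * Real.exp (-‖x‖ ^ 2 / 2)) with hf
  have hfm : Measurable f := by fun_prop
  have hS : MeasurableSet {y | y - w ∈ F} := (measurable_sub_const w) hF
  have hFl : ∀ x, l • x ∈ F ↔ x ∈ F := fun x =>
    ⟨fun h => by simpa [smul_smul, inv_mul_cancel₀ hl0.ne'] using hcone l⁻¹ (by positivity) _ h,
      fun h => hcone l hl0 x h⟩
  have key : ∀ x, f x ≤ ENNReal.ofReal (Real.exp (1 / 2)) * f (l • x + w) := by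
    intro x
    rw [hf]
    simp only
    rw [← ENNReal.ofReal_mul (by positivity)]
    apply ENNReal.ofReal_le_ofReal
    rw [mul_left_comm, ← Real.exp_add]
    gcongr
    have h1 : ‖l • x + w‖ ^ 2 ≤ ‖x‖ ^ 2 + 1 := by
      have h2 : ‖l • x + w‖ ≤ l * ‖x‖ + ‖w‖ := by
        refine (norm_add_le _ _).trans ?_
        rw [norm_smul, Real.norm_of_nonneg hl0.le]
      have h3 : ‖l • x + w‖ ^ 2 ≤ (l * ‖x‖ + ‖w‖) ^ 2 := by gcongr
      -- Young's inequality with parameter `e`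
      have h4 : (l * ‖x‖ + ‖w‖) ^ 2 ≤ (1 + e) * (l * ‖x‖) ^ 2 + (1 + 1 / e) * ‖w‖ ^ 2 := by
        have h5 : (1 + e) * (l * ‖x‖) ^ 2 + (1 + 1 / e) * ‖w‖ ^ 2 - (l * ‖x‖ + ‖w‖) ^ 2
          = (e * (l * ‖x‖) - ‖w‖) ^ 2 / e := by field_simp; ring
        have : 0 ≤ (e * (l * ‖x‖) - ‖w‖) ^ 2 / e := by positivity
        linarith
      have h6 : (1 + e) * (l * ‖x‖) ^ 2 = ‖x‖ ^ 2 := by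
        rw [mul_pow, hl2, ← mul_assoc, mul_inv_cancel₀ (by positivity), one_mul]
      have h7 : 1 + 1 / e = (k : ℝ) + 2 := by rw [he]; field_simp; ring
      rw [h6, h7] at h4
      linarith
    linarith
  have hlk : 1 ≤ Real.exp (1 / 2) * l ^ k := by
    have h1 : (1 + e) ^ k ≤ Real.exp 1 := by
      calc (1 + e) ^ k ≤ (Real.exp e) ^ k := by
            gcongr
            linarith [Real.add_one_le_exp e]
        _ = Real.exp (k * e) := (Real.exp_nat_mul e k).symm
        _ ≤ Real.exp 1 := by
            gcongr
            rw [he, mul_one_div, div_le_one (by positivity)]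
            linarith
    have h2 : 1 ≤ (Real.exp (1 / 2) * l ^ k) ^ 2 := by
      rw [mul_pow, ← pow_mul, mul_comm k 2, pow_mul, hl2, inv_pow, ← Real.exp_nat_mul,
        ← div_eq_mul_inv, le_div_iff₀ (by positivity)]
      norm_num
      simpa using h1
    have h3 : 0 ≤ Real.exp (1 / 2) * l ^ k := by positivity
    nlinarith
  rw [stdGaussian_eq_withDensity, withDensity_apply _ hF, withDensity_apply _ hS]
  -- the substitution `y = l • x + w`
  have hsub : ∫⁻ y in {y | y - w ∈ F}, f y = ENNReal.ofReal (l ^ k) * ∫⁻ x in F, f (l • x + w) := by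
    rw [← lintegral_indicator hS, ← lintegral_indicator hF]
    have h1 := lintegral_add_right_eq_self (μ := (volume : Measure V))
      ({y | y - w ∈ F}.indicator f) w
    have h2 : ∫⁻ x, ({y | y - w ∈ F}.indicator f) (x + w) ∂(Measure.map (l • ·) (volume : Measure V))
      = ∫⁻ x, F.indicator (fun x => f (l • x + w)) x := by
      have hm : Measurable fun x => ({y | y - w ∈ F}.indicator f) (x + w) :=
        (hfm.indicator hS).comp (measurable_add_const w)
      rw [lintegral_map hm (by fun_prop)]
      refine lintegral_congr fun x => ?_
      by_cases hx : x ∈ F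
      · rw [Set.indicator_of_mem (by simpa [hFl] using hx), Set.indicator_of_mem hx]
      · rw [Set.indicator_of_notMem (by simpa [hFl] using hx), Set.indicator_of_notMem hx]
    rw [Measure.map_addHaar_smul _ hl0.ne', lintegral_smul_measure, h1] at h2
    rw [← h2, smul_eq_mul, ← mul_assoc, ← ENNReal.ofReal_mul (by positivity),
      abs_of_nonneg (by positivity), mul_inv_cancel₀ (by positivity), ENNReal.ofReal_one, one_mul]
  change ∫⁻ x in F, f x ≤ ENNReal.ofReal (Real.exp 1) * ∫⁻ x in {y | y - w ∈ F}, f x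
  rw [hsub, ← mul_assoc, ← ENNReal.ofReal_mul (by positivity)]
  calc ∫⁻ x in F, f x ≤ ∫⁻ x in F, ENNReal.ofReal (Real.exp (1 / 2)) * f (l • x + w) :=
        lintegral_mono key
    _ = ENNReal.ofReal (Real.exp (1 / 2)) * ∫⁻ x in F, f (l • x + w) :=
        lintegral_const_mul _ (by fun_prop)
    _ ≤ _ := by
        gcongr
        have : Real.exp 1 = Real.exp (1 / 2) * Real.exp (1 / 2) := by
          rw [← Real.exp_add]; norm_num
        rw [this, mul_assoc]
        exact le_mul_of_one_le_right (by positivity) hlk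

/-- A linear combination of independent standard Gaussian vectors is a multiple of a standard
Gaussian vector, so it hits a cone with the same probability. -/
theorem stdGaussian_prod_linearCombination_mem_cone {F : Set V} (hF : MeasurableSet F)
    (hcone : ∀ t : ℝ, 0 < t → ∀ x ∈ F, t • x ∈ F) {a b : ℝ} (ha : a ≠ 0) :
    ((stdGaussian V).prod (stdGaussian V)) {p | b • p.1 - a • p.2 ∈ F} = stdGaussian V F := by
  set s : ℝ := Real.sqrt (a ^ 2 + b ^ 2) with hs
  have hs0 : 0 < s := Real.sqrt_pos.2 (by positivity)
  have hs2 : s ^ 2 = a ^ 2 + b ^ 2 := Real.sq_sqrt (by positivity)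
  have hmap : ((stdGaussian V).prod (stdGaussian V)).map (fun p => b • p.1 - a • p.2)
      = (stdGaussian V).map (s • ·) := by
    apply Measure.ext_of_charFun
    ext t
    rw [charFun_map_smul, charFun_stdGaussian, charFun_apply,
      integral_map (by fun_prop) (by fun_prop)]
    have h1 : ∀ p : V × V, Complex.exp (⟪b • p.1 - a • p.2, t⟫ * Complex.I) =
        Complex.exp (⟪p.1, b • t⟫ * Complex.I) * Complex.exp (⟪p.2, (-a) • t⟫ * Complex.I) := by
      intro p
      rw [← Complex.exp_add, ← add_mul, inner_sub_left, real_inner_smul_left, real_inner_smul_left,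
        real_inner_smul_right, real_inner_smul_right]
      push_cast
      ring_nf
    simp_rw [h1]
    rw [integral_prod_mul (fun x => Complex.exp (⟪x, b • t⟫ * Complex.I))
      (fun x => Complex.exp (⟪x, (-a) • t⟫ * Complex.I)), ← charFun_apply, ← charFun_apply,
      charFun_stdGaussian, charFun_stdGaussian, ← Complex.exp_add]
    congr 1
    norm_cast
    rw [norm_smul, norm_smul, norm_smul, mul_pow, mul_pow, mul_pow, Real.norm_eq_abs,
      Real.norm_eq_abs, Real.norm_eq_abs, sq_abs, sq_abs, sq_abs, hs2]
    ring
  have h := congrArg (fun μ => μ F) hmap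
  rw [Measure.map_apply (by fun_prop) hF, Measure.map_apply (by fun_prop) hF] at h
  refine h.trans (congrArg _ ?_)
  ext x
  exact ⟨fun hx => by simpa [smul_smul, inv_mul_cancel₀ hs0.ne'] using hcone s⁻¹ (by positivity) _ hx,
      fun hx => hcone s hs0 x hx⟩

/-- Along a unit vector and on its orthogonal complement, a standard Gaussian vector has independent
standard Gaussian components. -/
theorem stdGaussian_eq_map_prod_orthogonal {z : V} (hz : ‖z‖ = 1) :
    stdGaussian V = ((gaussianReal 0 1).prod (stdGaussian ((ℝ ∙ z)ᗮ : Submodule ℝ V))).map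
      (fun q => q.1 • z + (q.2 : V)) := by
  symm
  apply Measure.ext_of_charFun
  ext t
  rw [charFun_stdGaussian, charFun_apply, integral_map (by fun_prop) (by fun_prop)]
  set H : Submodule ℝ V := (ℝ ∙ z)ᗮ with hH
  have h1 : ∀ q : ℝ × H, Complex.exp (⟪q.1 • z + (q.2 : V), t⟫ * Complex.I) =
      Complex.exp ((⟪z, t⟫ : ℝ) * q.1 * Complex.I) *
        Complex.exp (⟪q.2, H.orthogonalProjectionOnto t⟫ * Complex.I) := by
    intro q
    rw [← Complex.exp_add, ← add_mul, inner_add_left, real_inner_smul_left,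
      Submodule.inner_orthogonalProjectionOnto_eq_of_mem_left]
    push_cast
    ring_nf
  simp_rw [h1]
  rw [integral_prod_mul (fun x : ℝ => Complex.exp ((⟪z, t⟫ : ℝ) * x * Complex.I))
      (fun x => Complex.exp (⟪x, H.orthogonalProjectionOnto t⟫ * Complex.I)), ← charFun_apply_real,
      ← charFun_apply, charFun_stdGaussian, charFun_gaussianReal, ← Complex.exp_add]
  congr 1
  have h2 : ‖t‖ ^ 2 = ⟪z, t⟫ ^ 2 + ‖H.orthogonalProjectionOnto t‖ ^ 2 := by
    have h3 := Submodule.norm_sq_eq_add_norm_sq_projection t (ℝ ∙ z)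
    rw [h3]
    congr 1
    rw [← Submodule.norm_coe, Submodule.coe_orthogonalProjectionOnto_apply,
      Submodule.starProjection_unit_singleton ℝ hz, norm_smul, hz,
      mul_one, Real.norm_eq_abs, sq_abs]
  push_cast
  rw [← Complex.ofReal_pow ‖t‖, h2]
  push_cast
  simp
  ring

/-- The line in which the plane spanned by two independent standard Gaussian vectors `X, Y` meets
the hyperplane `z^⊥` has uniform direction: its spanning vector `⟪z, Y⟫ • X - ⟪z, X⟫ • Y` hits a
cone at most as often as a standard Gaussian vector of the hyperplane does. -/
theorem stdGaussian_prod_plane_inter_hyperplane_mem_cone_le {z : V} (hz : ‖z‖ = 1) {S : Set V}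
    (hS : MeasurableSet S) (hcone : ∀ t : ℝ, 0 < t → ∀ x ∈ S, t • x ∈ S) :
    ((stdGaussian V).prod (stdGaussian V)) {p | ⟪z, p.2⟫ • p.1 - ⟪z, p.1⟫ • p.2 ∈ S} ≤
      stdGaussian ((ℝ ∙ z)ᗮ : Submodule ℝ V) {y | (y : V) ∈ S} := by
  set H : Submodule ℝ V := (ℝ ∙ z)ᗮ with hH
  set F : Set H := {y | (y : V) ∈ S} with hFdef
  have hF : MeasurableSet F := measurable_subtype_coe hS
  have hFc : ∀ t : ℝ, 0 < t → ∀ x ∈ F, t • x ∈ F := fun t ht x hx => hcone t ht x hx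
  set G : Measure ℝ := gaussianReal 0 1 with hG
  set μ : Measure H := stdGaussian H with hμ
  have hzH : ∀ y : H, ⟪z, (y : V)⟫ = 0 := fun y =>
    Submodule.mem_orthogonal_singleton_iff_inner_right.1 y.2
  have hzz : ⟪z, z⟫ = 1 := by rw [real_inner_self_eq_norm_sq, hz, one_pow]
  set T : Set ((ℝ × H) × (ℝ × H)) := {q | q.2.1 • q.1.2 - q.1.1 • q.2.2 ∈ F} with hT
  have hTm : MeasurableSet T := by
    have : Measurable fun q : (ℝ × H) × (ℝ × H) => q.2.1 • q.1.2 - q.1.1 • q.2.2 := by fun_prop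
    exact this hF
  have hmD : MeasurableSet {p : V × V | ⟪z, p.2⟫ • p.1 - ⟪z, p.1⟫ • p.2 ∈ S} := by
    have : Measurable fun p : V × V => ⟪z, p.2⟫ • p.1 - ⟪z, p.1⟫ • p.2 := by fun_prop
    exact this hS
  have h1 : ((stdGaussian V).prod (stdGaussian V)) {p | ⟪z, p.2⟫ • p.1 - ⟪z, p.1⟫ • p.2 ∈ S} =
      ((G.prod μ).prod (G.prod μ)) T := by
    rw [stdGaussian_eq_map_prod_orthogonal hz, Measure.map_prod_map _ _ (by fun_prop) (by fun_prop),
      Measure.map_apply (by fun_prop) hmD]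
    congr 1
    ext ⟨⟨a, x⟩, ⟨b, y⟩⟩
    simp only [Set.mem_preimage, Set.mem_ofPred_eq, Prod.map, hT, hFdef, inner_add_right,
      real_inner_smul_right, hzz, hzH, mul_one, add_zero, Submodule.coe_sub, Submodule.coe_smul]
    have : b • (a • z + (x : V)) - a • (b • z + (y : V)) = b • (x : V) - a • (y : V) := by module
    rw [this]
    rfl
  have h2 : ((G.prod μ).prod (G.prod μ)) T =
      ∫⁻ a, ∫⁻ b, (μ.prod μ) {p | b • p.1 - a • p.2 ∈ F} ∂G ∂G := by
    have hf : Measurable (T.indicator (1 : (ℝ × H) × (ℝ × H) → ENNReal)) :=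
      measurable_one.indicator hTm
    rw [← lintegral_indicator_one hTm, lintegral_prod _ hf.aemeasurable,
      lintegral_prod _ hf.lintegral_prod_right'.aemeasurable]
    refine lintegral_congr fun a => ?_
    have h3 : ∀ x : H, ∫⁻ q, T.indicator 1 ((a, x), q) ∂(G.prod μ) =
        ∫⁻ b, ∫⁻ y, T.indicator (1 : (ℝ × H) × (ℝ × H) → ENNReal) ((a, x), (b, y)) ∂μ ∂G :=
      fun x => lintegral_prod _ (hf.comp measurable_prodMk_left).aemeasurable
    simp_rw [h3]
    have hf2 : Measurable fun q : (H × ℝ) × H =>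
        T.indicator (1 : (ℝ × H) × (ℝ × H) → ENNReal) ((a, q.1.1), (q.1.2, q.2)) :=
      hf.comp (by fun_prop)
    rw [lintegral_lintegral_swap hf2.lintegral_prod_right'.aemeasurable]
    refine lintegral_congr fun b => ?_
    have hm : MeasurableSet {p : H × H | b • p.1 - a • p.2 ∈ F} := by
      have : Measurable fun p : H × H => b • p.1 - a • p.2 := by fun_prop
      exact this hF
    rw [← lintegral_indicator_one hm,
      lintegral_prod _ (measurable_one.indicator hm).aemeasurable]
    rfl
  rw [h1, h2]
  -- for `a ≠ 0` the vector `b • x - a • y` is a nondegenerate Gaussian vector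
  have h4 : ∀ᵐ a ∂G, a ≠ 0 := by
    have := nullSingletonClass_gaussianReal (μ := 0) (v := 1) one_ne_zero
    refine measure_mono_null ?_ (measure_singleton (μ := G) 0)
    intro a ha
    simpa using ha
  calc ∫⁻ a, ∫⁻ b, (μ.prod μ) {p | b • p.1 - a • p.2 ∈ F} ∂G ∂G
      = ∫⁻ a, ∫⁻ b, μ F ∂G ∂G := by
        refine lintegral_congr_ae ?_
        filter_upwards [h4] with a ha
        refine lintegral_congr fun b => ?_
        exact stdGaussian_prod_linearCombination_mem_cone hF hFc ha
    _ ≤ μ F := by simp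

theorem gaussianReal_Ioo_ge {t : ℝ} (ht1 : t ≤ 1) :
    ENNReal.ofReal (t * gaussianPDFReal 0 1 1) ≤ gaussianReal 0 1 (Set.Ioo 0 t) := by
  rw [gaussianReal_apply _ one_ne_zero, mul_comm, ENNReal.ofReal_mul (gaussianPDFReal_nonneg _ _ _)]
  calc ENNReal.ofReal (gaussianPDFReal 0 1 1) * ENNReal.ofReal t
      = ∫⁻ _ in Set.Ioo (0 : ℝ) t, ENNReal.ofReal (gaussianPDFReal 0 1 1) := by
        simp
    _ ≤ _ := by
        refine setLIntegral_mono' measurableSet_Ioo fun x hx => ?_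
        rw [gaussianPDF]
        refine ENNReal.ofReal_le_ofReal ?_
        rw [gaussianPDFReal, gaussianPDFReal]
        gcongr
        · simpa using hx.1.le
        · exact hx.2.le.trans ht1

/-- If the cone `C` contains `x + t • r` for all `t ≥ 0` and all `x` in its facet `S ∩ z^⊥`, where
the unit vector `r` has distance `⟪z, r⟫` from the hyperplane `z^⊥`, then the slab of `C` of width
`⟪z, r⟫ / dim V` over the facet consists of translates of the facet by vectors of length at most
`1 / dim V`, each of which carries a constant fraction of the measure of the facet. -/
theorem stdGaussian_facet_le_cone {z r : V} (hz : ‖z‖ = 1) (hr : ‖r‖ = 1) (hzr : 0 < ⟪z, r⟫)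
    (hV : 2 ≤ Module.finrank ℝ V) {S C : Set V}
    (hS : MeasurableSet S) (hC : MeasurableSet C)
    (hcone : ∀ t : ℝ, 0 < t → ∀ x ∈ S, t • x ∈ S)
    (hSC : ∀ x ∈ S, ⟪z, x⟫ = 0 → ∀ t : ℝ, 0 ≤ t → x + t • r ∈ C) :
    stdGaussian ((ℝ ∙ z)ᗮ : Submodule ℝ V) {y | (y : V) ∈ S} ≤
      ENNReal.ofReal (Real.exp 1 * (gaussianPDFReal 0 1 1)⁻¹ * (Module.finrank ℝ V / ⟪z, r⟫)) *
        stdGaussian V C := by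
  set H : Submodule ℝ V := (ℝ ∙ z)ᗮ with hH
  set F : Set H := {y | (y : V) ∈ S} with hFdef
  have hF : MeasurableSet F := measurable_subtype_coe hS
  have hFc : ∀ t : ℝ, 0 < t → ∀ x ∈ F, t • x ∈ F := fun t ht x hx => hcone t ht x hx
  set μ : Measure H := stdGaussian H with hμ
  set h : ℝ := ⟪z, r⟫ with hh
  set n : ℕ := Module.finrank ℝ V with hn
  have hn2 : (2 : ℝ) ≤ n := by exact_mod_cast hV
  have hh1 : h ≤ 1 := by
    have := real_inner_le_norm z r
    rwa [hz, hr, mul_one] at this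
  have hφ : 0 < gaussianPDFReal 0 1 1 := gaussianPDFReal_pos _ _ _ one_ne_zero
  have hzH : ∀ y : H, ⟪z, (y : V)⟫ = 0 := fun y =>
    Submodule.mem_orthogonal_singleton_iff_inner_right.1 y.2
  have hfr : (Module.finrank ℝ H : ℝ) + 1 = n := by
    have h1 := Submodule.finrank_add_finrank_orthogonal (ℝ ∙ z)
    rw [finrank_span_singleton (by rw [← norm_ne_zero_iff, hz]; exact one_ne_zero)] at h1
    rw [hn, ← h1]
    push_cast
    ring
  set rH : H := H.orthogonalProjectionOnto r with hrH
  have hrH1 : ‖rH‖ ≤ 1 := by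
    rw [← hr]
    exact H.norm_orthogonalProjectionOnto_apply_le r
  have hrdec : r = h • z + (rH : V) := by
    have h1 := Submodule.starProjection_add_starProjection_orthogonal (K := ℝ ∙ z) r
    rw [Submodule.starProjection_unit_singleton ℝ hz] at h1
    exact h1.symm
  -- the section of `C` at height `ξ` contains the translate of the facet by `w ξ`
  set w : ℝ → H := fun ξ => (ξ / h) • rH with hw
  have hslab : ∀ ξ ∈ Set.Ioo 0 (h / n),
      ENNReal.ofReal (Real.exp 1)⁻¹ * μ F ≤ μ {y | ξ • z + (y : V) ∈ C} := by
    rintro ξ ⟨hξ0, hξ⟩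
    have hw1 : ‖w ξ‖ ≤ 1 / n := by
      rw [hw]
      simp only
      rw [norm_smul, Real.norm_of_nonneg (by positivity)]
      have : ξ / h ≤ 1 / n := by
        rw [div_le_iff₀ hzr]
        calc ξ ≤ h / n := hξ.le
          _ = 1 / n * h := by ring
      calc ξ / h * ‖rH‖ ≤ (1 / n) * 1 := by gcongr
        _ = 1 / n := mul_one _
    have hw2 : ((Module.finrank ℝ H : ℝ) + 2) * ‖w ξ‖ ^ 2 ≤ 1 := by
      have h1 : (Module.finrank ℝ H : ℝ) + 2 = n + 1 := by linarith
      rw [h1]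
      calc ((n : ℝ) + 1) * ‖w ξ‖ ^ 2 ≤ (n + 1) * (1 / n) ^ 2 := by gcongr
        _ ≤ 1 := by
          rw [div_pow, one_pow, mul_one_div, div_le_one (by positivity)]
          nlinarith
    have h1 := stdGaussian_cone_le_translate hF hFc hw2
    have h2 : {y : H | y - w ξ ∈ F} ⊆ {y | ξ • z + (y : V) ∈ C} := by
      intro y hy
      have h3 := hSC ((y - w ξ : H) : V) hy (hzH _) (ξ / h) (by positivity)
      have h4 : ((y - w ξ : H) : V) + (ξ / h) • r = ξ • z + (y : V) := by
        rw [Submodule.coe_sub, hw]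
        simp only [Submodule.coe_smul]
        rw [hrdec, smul_add, smul_smul, div_mul_cancel₀ _ hzr.ne']
        module
      rwa [h4] at h3
    calc ENNReal.ofReal (Real.exp 1)⁻¹ * μ F
        ≤ ENNReal.ofReal (Real.exp 1)⁻¹ * (ENNReal.ofReal (Real.exp 1) * μ {y | y - w ξ ∈ F}) := by
          gcongr
      _ = μ {y | y - w ξ ∈ F} := by
          rw [← mul_assoc, ← ENNReal.ofReal_mul (by positivity),
            inv_mul_cancel₀ (Real.exp_ne_zero _), ENNReal.ofReal_one, one_mul]
      _ ≤ _ := measure_mono h2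
  have hC1 : stdGaussian V C = ∫⁻ ξ, μ {y | ξ • z + (y : V) ∈ C} ∂(gaussianReal 0 1) := by
    have hm : Measurable fun q : ℝ × H => q.1 • z + (q.2 : V) := by fun_prop
    rw [stdGaussian_eq_map_prod_orthogonal hz, Measure.map_apply hm hC,
      Measure.prod_apply (hm hC)]
    rfl
  have hmain : ENNReal.ofReal ((Real.exp 1)⁻¹ * (h / n * gaussianPDFReal 0 1 1)) * μ F ≤
      stdGaussian V C := by
    rw [hC1]
    calc ENNReal.ofReal ((Real.exp 1)⁻¹ * (h / n * gaussianPDFReal 0 1 1)) * μ F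
        ≤ ENNReal.ofReal (Real.exp 1)⁻¹ * gaussianReal 0 1 (Set.Ioo 0 (h / n)) * μ F := by
          rw [ENNReal.ofReal_mul (by positivity)]
          gcongr
          exact gaussianReal_Ioo_ge ((div_le_one (by positivity)).2 (by linarith))
      _ = ∫⁻ _ in Set.Ioo 0 (h / n), ENNReal.ofReal (Real.exp 1)⁻¹ * μ F ∂(gaussianReal 0 1) := by
          rw [setLIntegral_const]
          ring
      _ ≤ ∫⁻ ξ in Set.Ioo 0 (h / n), μ {y | ξ • z + (y : V) ∈ C} ∂(gaussianReal 0 1) :=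
          setLIntegral_mono' measurableSet_Ioo hslab
      _ ≤ _ := setLIntegral_le_lintegral _ _
  calc μ F = ENNReal.ofReal (Real.exp 1 * (gaussianPDFReal 0 1 1)⁻¹ * (n / h)) *
        (ENNReal.ofReal ((Real.exp 1)⁻¹ * (h / n * gaussianPDFReal 0 1 1)) * μ F) := by
        rw [← mul_assoc, ← ENNReal.ofReal_mul (by positivity)]
        have : Real.exp 1 * (gaussianPDFReal 0 1 1)⁻¹ * (n / h) *
          ((Real.exp 1)⁻¹ * (h / n * gaussianPDFReal 0 1 1)) = 1 := by
          have := Real.exp_ne_zero 1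
          have : (n : ℝ) ≠ 0 := by positivity
          field_simp
        rw [this, ENNReal.ofReal_one, one_mul]
    _ ≤ _ := by gcongr

end Gaussian

/-! ### Vertices of polytopes and polyhedra -/

/-- An extreme point of the convex hull of a finite set is strictly exposed among the points of that
set. -/
theorem exists_lt_of_mem_extremePoints_convexHull {X : Type*} [NormedAddCommGroup X]
    [NormedSpace ℝ X] {W : Set X} (hW : W.Finite) {v : X}
    (hv : v ∈ (convexHull ℝ W).extremePoints ℝ) :
    ∃ f : StrongDual ℝ X, ∀ x ∈ W, x ≠ v → f x < f v := by
  have hsub : convexHull ℝ (W \ {v}) ⊆ convexHull ℝ W \ {v} := by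
    have h1 := ((convex_convexHull ℝ W).mem_extremePoints_iff_convex_sdiff.1 hv).2
    refine convexHull_min ?_ h1
    intro x hx
    exact ⟨subset_convexHull ℝ W hx.1, hx.2⟩
  have hnot : v ∉ convexHull ℝ (W \ {v}) := fun h => (hsub h).2 rfl
  obtain ⟨f, u, h1, h2⟩ := geometric_hahn_banach_closed_point (convex_convexHull ℝ (W \ {v}))
    ((hW.subset Set.sdiff_subset).isClosed_convexHull ℝ) hnot
  exact ⟨f, fun x hx hxv => (h1 x (subset_convexHull ℝ _ ⟨hx, hxv⟩)).trans h2⟩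

section Polyhedron

variable {m n : ℕ} (A : Matrix (Fin m) (Fin n) ℝ) (b : Fin m → ℝ)

theorem continuous_mulVec_apply (i : Fin m) :
    Continuous fun x : EuclideanSpace ℝ (Fin n) => A.mulVec x.ofLp i := by
  simp only [Matrix.mulVec, dotProduct]
  fun_prop

theorem isClosed_polyhedron : IsClosed (polyhedron A b) := by
  have : polyhedron A b = ⋂ i, {x | A.mulVec x.ofLp i ≤ b i} := by
    ext x
    simp [polyhedron]
  rw [this]
  exact isClosed_iInter fun i => isClosed_le (continuous_mulVec_apply A i) continuous_const

theorem convex_polyhedron : Convex ℝ (polyhedron A b) := by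
  intro x hx y hy s t hs ht hst i
  simp only [WithLp.ofLp_add, WithLp.ofLp_smul, Matrix.mulVec_add, Matrix.mulVec_smul, Pi.add_apply,
    Pi.smul_apply, smul_eq_mul]
  calc s * A.mulVec x.ofLp i + t * A.mulVec y.ofLp i ≤ s * b i + t * b i := by
        gcongr
        · exact hx i
        · exact hy i
    _ = b i := by rw [← add_mul, hst, one_mul]

/-- A vertex is determined by the set of inequalities that it satisfies with equality: from two
vertices `x, y` with the same tight inequalities one can move a little in the directions
`±(x - y)`. -/
theorem finite_vertices_polyhedron : (vertices (polyhedron A b)).Finite := by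
  refine Set.Finite.of_finite_image (f := fun x => {i | A.mulVec x.ofLp i = b i})
    (Set.toFinite _) ?_
  intro x hx y hy hxy
  simp only at hxy
  have htight : ∀ i, A.mulVec x.ofLp i = b i → A.mulVec y.ofLp i = b i := fun i hi => by
    have : i ∈ {i | A.mulVec x.ofLp i = b i} := hi
    rw [hxy] at this
    exact this
  have hline : ∀ (t : ℝ) (i : Fin m), A.mulVec (x + t • (x - y)).ofLp i =
      A.mulVec x.ofLp i + t * (A.mulVec x.ofLp i - A.mulVec y.ofLp i) := by
    intro t i
    simp [Matrix.mulVec_add, Matrix.mulVec_smul, Matrix.mulVec_sub]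
  have hev : ∀ᶠ t in nhds (0 : ℝ), x + t • (x - y) ∈ polyhedron A b := by
    have : ∀ i, ∀ᶠ t in nhds (0 : ℝ), A.mulVec (x + t • (x - y)).ofLp i ≤ b i := by
      intro i
      simp_rw [hline]
      rcases (hx.1 i).eq_or_lt with h | h
      · refine Filter.Eventually.of_forall fun t => ?_
        rw [h, htight i h]
        simp
      · have hc : Continuous fun t : ℝ =>
          A.mulVec x.ofLp i + t * (A.mulVec x.ofLp i - A.mulVec y.ofLp i) := by fun_prop
        filter_upwards [hc.continuousAt.eventually_lt (continuousAt_const (y := b i))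
          (by simpa using h)] with t ht
        exact ht.le
    exact Filter.eventually_all.2 this
  have hev2 : ∀ᶠ t in nhds (0 : ℝ), x + (-t) • (x - y) ∈ polyhedron A b := by
    have : Filter.Tendsto (fun t : ℝ => -t) (nhds 0) (nhds 0) := by
      simpa using (continuous_neg (G := ℝ)).tendsto 0
    exact this.eventually hev
  obtain ⟨t, ⟨h1, h2⟩, ht⟩ := ((hev.and hev2).filter_mono nhdsWithin_le_nhds |>.and
    (self_mem_nhdsWithin (a := (0 : ℝ)) (s := Set.Ioi 0))).exists
  have h3 := hx.2 h1 h2 ⟨1 / 2, 1 / 2, by norm_num, by norm_num, by norm_num, by module⟩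
  have h4 : t • (x - y) = 0 := by simpa using h3
  rcases smul_eq_zero.1 h4 with h | h
  · exact absurd h (ne_of_gt ht)
  · exact sub_eq_zero.1 h

end Polyhedron

/-! ### Normal cones -/

section NormalCone

variable {n : ℕ} {P : Set (EuclideanSpace ℝ (Fin n))}

theorem convexHull_vertices (hconv : Convex ℝ P) (hcomp : IsCompact P)
    (hfin : (vertices P).Finite) : convexHull ℝ (vertices P) = P := by
  rw [← (hfin.isClosed_convexHull ℝ).closure_eq]
  exact closure_convexHull_extremePoints hcomp hconv

theorem mem_normalCone_iff_vertices (hconv : Convex ℝ P) (hcomp : IsCompact P)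
    (hfin : (vertices P).Finite) {v c : EuclideanSpace ℝ (Fin n)} :
    c ∈ normalCone P v ↔ ∀ x ∈ vertices P, ⟪c, x⟫ ≤ ⟪c, v⟫ := by
  refine ⟨fun h x hx => h x hx.1, fun h x hx => ?_⟩
  have h1 : Convex ℝ {x | ⟪c, x⟫ ≤ ⟪c, v⟫} :=
    convex_halfSpace_le (innerₗ (EuclideanSpace ℝ (Fin n)) c).isLinear _
  rw [← convexHull_vertices hconv hcomp hfin] at hx
  exact convexHull_min h h1 hx

theorem isClosed_normalCone (v : EuclideanSpace ℝ (Fin n)) : IsClosed (normalCone P v) := by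
  have : normalCone P v = ⋂ x ∈ P, {c | ⟪c, x⟫ ≤ ⟪c, v⟫} := by
    ext c
    simp [normalCone]
  rw [this]
  exact isClosed_biInter fun x _ => isClosed_le (by fun_prop) (by fun_prop)

theorem convex_normalCone (v : EuclideanSpace ℝ (Fin n)) : Convex ℝ (normalCone P v) := by
  intro c hc d hd s t hs ht _ x hx
  simp only [inner_add_left, real_inner_smul_left]
  have := hc x hx
  have := hd x hx
  gcongr

theorem smul_mem_normalCone {v c : EuclideanSpace ℝ (Fin n)} (hc : c ∈ normalCone P v) {t : ℝ}
    (ht : 0 ≤ t) : t • c ∈ normalCone P v := by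
  intro x hx
  simp only [real_inner_smul_left]
  exact mul_le_mul_of_nonneg_left (hc x hx) ht

/-- If `P` contains a ball around `x₀`, then `v - x₀` is in the interior of the dual of the normal
cone at `v`. -/
theorem mul_norm_le_inner_of_mem_normalCone {x₀ v c : EuclideanSpace ℝ (Fin n)} {ρ : ℝ}
    (hρ : 0 ≤ ρ) (hball : Metric.closedBall x₀ ρ ⊆ P) (hc : c ∈ normalCone P v) :
    ρ * ‖c‖ ≤ ⟪c, v - x₀⟫ := by
  rcases eq_or_ne c 0 with rfl | hc0
  · simp
  have hn : 0 < ‖c‖ := norm_pos_iff.2 hc0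
  have h1 : x₀ + (ρ / ‖c‖) • c ∈ P := by
    apply hball
    rw [mem_closedBall_iff_norm, add_sub_cancel_left, norm_smul, Real.norm_of_nonneg (by positivity),
      div_mul_cancel₀ _ hn.ne']
  have h2 := hc _ h1
  rw [inner_add_right, real_inner_smul_right, real_inner_self_eq_norm_sq] at h2
  rw [inner_sub_right]
  have : ρ / ‖c‖ * ‖c‖ ^ 2 = ρ * ‖c‖ := by field_simp
  linarith

/-- The normal cone is generated by its unit rays, in dual form: a linear functional that is
nonnegative on the unit rays is nonnegative on the cone. This is the Krein–Milman theorem for the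
compact base `{c : ⟪c, v - x₀⟫ = 1}` of the cone, where `x₀` is an interior point of `P`. -/
theorem inner_nonneg_of_mem_normalCone (hfull : (interior P).Nonempty)
    {v w c : EuclideanSpace ℝ (Fin n)} (hw : ∀ u ∈ unitRays (normalCone P v), 0 ≤ ⟪w, u⟫)
    (hc : c ∈ normalCone P v) : 0 ≤ ⟪w, c⟫ := by
  obtain ⟨x₀, hx₀⟩ := hfull
  obtain ⟨ρ, hρ, hball⟩ := Metric.nhds_basis_closedBall.mem_iff.1 (mem_interior_iff_mem_nhds.1 hx₀)
  set q := v - x₀ with hq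
  have hpos : ∀ d ∈ normalCone P v, ρ * ‖d‖ ≤ ⟪d, q⟫ := fun d hd =>
    mul_norm_le_inner_of_mem_normalCone hρ.le hball hd
  have hpos' : ∀ d ∈ normalCone P v, d ≠ 0 → 0 < ⟪d, q⟫ := fun d hd hd0 =>
    lt_of_lt_of_le (mul_pos hρ (norm_pos_iff.2 hd0)) (hpos d hd)
  set B := normalCone P v ∩ {d | ⟪d, q⟫ = 1} with hB
  have hBcl : IsClosed B :=
    (isClosed_normalCone v).inter (isClosed_eq (by fun_prop) continuous_const)
  have hBcomp : IsCompact B := by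
    refine Metric.isCompact_of_isClosed_isBounded hBcl ?_
    refine (Metric.isBounded_closedBall (x := 0) (r := 1 / ρ)).subset ?_
    rintro d ⟨hd, hd1⟩
    rw [mem_closedBall_zero_iff, le_div_iff₀ hρ, mul_comm]
    exact (hpos d hd).trans (le_of_eq hd1)
  have hBconv : Convex ℝ B := by
    refine (convex_normalCone v).inter ?_
    intro d hd e he s t _ _ hst
    simp only [Set.mem_ofPred_eq] at hd he ⊢
    rw [inner_add_left, real_inner_smul_left, real_inner_smul_left, hd, he, mul_one, mul_one, hst]
  have hext : ∀ e ∈ B.extremePoints ℝ, 0 ≤ ⟪w, e⟫ := by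
    rintro e ⟨⟨heN, heq⟩, hee⟩
    simp only [Set.mem_ofPred_eq] at heq
    have he0 : e ≠ 0 := by
      rintro rfl
      simp at heq
    have hn : 0 < ‖e‖ := norm_pos_iff.2 he0
    have hu : ‖e‖⁻¹ • e ∈ unitRays (normalCone P v) := by
      refine ⟨norm_smul_inv_norm he0, ?_, ?_⟩
      · rintro _ ⟨t, ht, rfl⟩
        exact smul_mem_normalCone (smul_mem_normalCone heN (by positivity)) ht
      -- scaling the end points of a segment through the ray to the base turns it into a segment
      -- of the base through `e`
      · rintro x₁ hx₁ x₂ hx₂ x ⟨t, ht, rfl⟩ ⟨α, β, hα, hβ, hαβ, hx⟩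
        rcases eq_or_ne x₁ 0 with rfl | h1
        · exact ⟨0, le_rfl, by simp⟩
        rcases eq_or_ne x₂ 0 with rfl | h2
        · refine ⟨α⁻¹ * t, by positivity, ?_⟩
          rw [smul_zero, add_zero] at hx
          rw [mul_smul, ← hx, smul_smul, inv_mul_cancel₀ hα.ne', one_smul]
        have hq1 := hpos' x₁ hx₁ h1
        have hq2 := hpos' x₂ hx₂ h2
        set s := t * ‖e‖⁻¹ with hs
        have hse : α • x₁ + β • x₂ = s • e := by rw [hx, smul_smul]
        have hsq : α * ⟪x₁, q⟫ + β * ⟪x₂, q⟫ = s := by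
          have := congrArg (fun y => ⟪y, q⟫) hse
          simpa [inner_add_left, real_inner_smul_left, heq] using this
        have hs0 : 0 < s := by rw [← hsq]; positivity
        have h3 := hee (x₁ := ⟪x₁, q⟫⁻¹ • x₁)
          ⟨smul_mem_normalCone hx₁ (by positivity), by
            simp only [Set.mem_ofPred_eq, real_inner_smul_left]; exact inv_mul_cancel₀ hq1.ne'⟩
          (x₂ := ⟪x₂, q⟫⁻¹ • x₂)
          ⟨smul_mem_normalCone hx₂ (by positivity), by
            simp only [Set.mem_ofPred_eq, real_inner_smul_left]; exact inv_mul_cancel₀ hq2.ne'⟩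
          ⟨α * ⟪x₁, q⟫ / s, β * ⟪x₂, q⟫ / s, by positivity, by positivity,
            by rw [← add_div, hsq, div_self hs0.ne'], by
              rw [smul_smul, smul_smul]
              have e1 : α * ⟪x₁, q⟫ / s * ⟪x₁, q⟫⁻¹ = s⁻¹ * α := by field_simp
              have e2 : β * ⟪x₂, q⟫ / s * ⟪x₂, q⟫⁻¹ = s⁻¹ * β := by field_simp
              rw [e1, e2, mul_smul, mul_smul, ← smul_add, hse, smul_smul, inv_mul_cancel₀ hs0.ne',
                one_smul]⟩
        refine ⟨⟪x₁, q⟫ * ‖e‖, by positivity, ?_⟩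
        rw [smul_smul, mul_assoc, mul_inv_cancel₀ hn.ne', mul_one, ← h3, smul_smul,
          mul_inv_cancel₀ hq1.ne', one_smul]
    have h := hw _ hu
    rw [real_inner_smul_right] at h
    exact nonneg_of_mul_nonneg_right h (by positivity)
  have hBle : ∀ d ∈ B, 0 ≤ ⟪w, d⟫ := by
    intro d hd
    rw [← closure_convexHull_extremePoints hBcomp hBconv] at hd
    have hcl : IsClosed {d : EuclideanSpace ℝ (Fin n) | 0 ≤ ⟪w, d⟫} :=
      isClosed_le continuous_const (by fun_prop)
    have hcv : Convex ℝ {d : EuclideanSpace ℝ (Fin n) | 0 ≤ ⟪w, d⟫} :=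
      convex_halfSpace_ge (innerₗ (EuclideanSpace ℝ (Fin n)) w).isLinear _
    exact closure_minimal (convexHull_min hext hcv) hcl hd
  rcases eq_or_ne c 0 with rfl | hc0
  · simp
  have hqc := hpos' c hc hc0
  have h := hBle (⟪c, q⟫⁻¹ • c) ⟨smul_mem_normalCone hc (by positivity), by
    simp only [Set.mem_ofPred_eq, real_inner_smul_left]; exact inv_mul_cancel₀ hqc.ne'⟩
  rw [real_inner_smul_right] at h
  exact nonneg_of_mul_nonneg_right h (by positivity)

theorem exists_forall_vertices_inner_lt (hconv : Convex ℝ P) (hcomp : IsCompact P)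
    (hfin : (vertices P).Finite) {v : EuclideanSpace ℝ (Fin n)} (hv : v ∈ vertices P) :
    ∃ c : EuclideanSpace ℝ (Fin n), ∀ x ∈ vertices P, x ≠ v → ⟪c, x⟫ < ⟪c, v⟫ := by
  have hv' : v ∈ (convexHull ℝ (vertices P)).extremePoints ℝ := by
    rwa [convexHull_vertices hconv hcomp hfin]
  obtain ⟨f, hf⟩ := exists_lt_of_mem_extremePoints_convexHull hfin hv'
  refine ⟨(InnerProductSpace.toDual ℝ _).symm f, fun x hx hxv => ?_⟩
  simpa [InnerProductSpace.toDual_symm_apply] using hf x hx hxv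

/-- Moving a little from `c` in the direction `w` does not leave the normal cone at `v`, provided
that `w` is constant on the set of vertices at which `c` attains its maximum. -/
theorem eventually_add_smul_mem_normalCone (hconv : Convex ℝ P) (hcomp : IsCompact P)
    (hfin : (vertices P).Finite) {v c w : EuclideanSpace ℝ (Fin n)} (hc : c ∈ normalCone P v)
    (hw : ∀ x ∈ vertices P, ⟪c, x⟫ = ⟪c, v⟫ → ⟪w, x⟫ = ⟪w, v⟫) :
    ∀ᶠ t in nhds (0 : ℝ), c + t • w ∈ normalCone P v := by
  simp_rw [mem_normalCone_iff_vertices hconv hcomp hfin]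
  refine hfin.eventually_all.2 fun x hx => ?_
  simp_rw [inner_add_left, real_inner_smul_left]
  rcases (hc x hx.1).eq_or_lt with h | h
  · refine Filter.Eventually.of_forall fun t => ?_
    rw [h, hw x hx h]
  · have h1 : Continuous fun t : ℝ => ⟪c, x⟫ + t * ⟪w, x⟫ := by fun_prop
    have h2 : Continuous fun t : ℝ => ⟪c, v⟫ + t * ⟪w, v⟫ := by fun_prop
    filter_upwards [h1.continuousAt.eventually_lt h2.continuousAt (by simpa using h)] with t ht
    exact ht.le

/-- The normal cone at a vertex `v` is full-dimensional, since it is a neighbourhood of a functional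
that is maximized only at `v`; so its unit rays span the space. -/
theorem span_unitRays_normalCone (hconv : Convex ℝ P) (hcomp : IsCompact P)
    (hfin : (vertices P).Finite) (hfull : (interior P).Nonempty) {v : EuclideanSpace ℝ (Fin n)}
    (hv : v ∈ vertices P) : Submodule.span ℝ (unitRays (normalCone P v)) = ⊤ := by
  rw [← Submodule.orthogonal_eq_bot_iff, Submodule.eq_bot_iff]
  intro w hw
  have hwu : ∀ u ∈ unitRays (normalCone P v), ⟪w, u⟫ = 0 := fun u hu =>
    Submodule.inner_left_of_mem_orthogonal (Submodule.subset_span hu) hw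
  have hwN : ∀ c ∈ normalCone P v, ⟪w, c⟫ = 0 := by
    intro c hc
    have h1 := inner_nonneg_of_mem_normalCone hfull (w := w) (fun u hu => (hwu u hu).ge) hc
    have h2 := inner_nonneg_of_mem_normalCone hfull (w := -w)
      (fun u hu => by rw [inner_neg_left, hwu u hu, neg_zero]) hc
    rw [inner_neg_left] at h2
    linarith
  obtain ⟨c, hc⟩ := exists_forall_vertices_inner_lt hconv hcomp hfin hv
  have hcN : c ∈ normalCone P v := (mem_normalCone_iff_vertices hconv hcomp hfin).2 fun x hx => by
    rcases eq_or_ne x v with rfl | h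
    · rfl
    · exact (hc x hx h).le
  have hev := eventually_add_smul_mem_normalCone hconv hcomp hfin (w := w) hcN fun x hx hxc => by
    rcases eq_or_ne x v with rfl | h
    · rfl
    · exact absurd hxc (hc x hx h).ne
  obtain ⟨t, h1, ht⟩ := (hev.filter_mono nhdsWithin_le_nhds |>.and
    (self_mem_nhdsWithin (a := (0 : ℝ)) (s := Set.Ioi 0))).exists
  have h2 := hwN _ h1
  rw [inner_add_right, hwN c hcN, zero_add, real_inner_smul_right] at h2
  rcases mul_eq_zero.1 h2 with h | h
  · exact absurd h (ne_of_gt ht)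
  · exact inner_self_eq_zero.1 h

/-- The face of `P` on which an extreme ray `u` of the normal cone at `v` attains its maximum is so
large that `u` spans its orthogonal complement: otherwise `u` could be moved in both directions
along a line inside of the normal cone. -/
theorem orthogonal_vectorSpan_unitRay (hconv : Convex ℝ P) (hcomp : IsCompact P)
    (hfin : (vertices P).Finite) {v u : EuclideanSpace ℝ (Fin n)}
    (hv : v ∈ P) (hu : u ∈ unitRays (normalCone P v)) :
    (vectorSpan ℝ {x ∈ P | ⟪u, x⟫ = ⟪u, v⟫})ᗮ = ℝ ∙ u := by
  have huN : u ∈ normalCone P v := hu.2.subset ⟨1, zero_le_one, by simp⟩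
  apply le_antisymm
  · intro w hw
    have hwF : ∀ x ∈ vertices P, ⟪u, x⟫ = ⟪u, v⟫ → ⟪w, x⟫ = ⟪w, v⟫ := by
      intro x hx hxu
      have h1 := Submodule.inner_left_of_mem_orthogonal
        (vsub_mem_vectorSpan ℝ (s := {x ∈ P | ⟪u, x⟫ = ⟪u, v⟫}) ⟨hx.1, hxu⟩ ⟨hv, rfl⟩) hw
      rw [vsub_eq_sub, inner_sub_right] at h1
      linarith
    have hev := eventually_add_smul_mem_normalCone hconv hcomp hfin (w := w) huN hwF
    have hev2 := eventually_add_smul_mem_normalCone hconv hcomp hfin (w := -w) huN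
      fun x hx hxu => by rw [inner_neg_left, inner_neg_left, hwF x hx hxu]
    obtain ⟨t, ⟨h1, h2⟩, ht⟩ := ((hev.and hev2).filter_mono nhdsWithin_le_nhds |>.and
      (self_mem_nhdsWithin (a := (0 : ℝ)) (s := Set.Ioi 0))).exists
    obtain ⟨s, -, hs⟩ := hu.2.left_mem_of_mem_openSegment h1 h2 (z := u)
      ⟨1, zero_le_one, by simp⟩ ⟨1 / 2, 1 / 2, by norm_num, by norm_num, by norm_num, by module⟩
    rw [Submodule.mem_span_singleton]
    refine ⟨t⁻¹ * (s - 1), ?_⟩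
    have ht0 : t ≠ 0 := ne_of_gt ht
    have h3 : t • w = (s - 1) • u := by
      rw [sub_smul, one_smul, ← hs]
      abel
    rw [mul_smul, ← h3, smul_smul, inv_mul_cancel₀ ht0, one_smul]
  · rw [Submodule.span_singleton_le_iff_mem, Submodule.mem_orthogonal]
    have h1 : vectorSpan ℝ {x ∈ P | ⟪u, x⟫ = ⟪u, v⟫} ≤ (ℝ ∙ u)ᗮ := by
      rw [vectorSpan, Submodule.span_le]
      rintro _ ⟨x, hx, y, hy, rfl⟩
      rw [SetLike.mem_coe, Submodule.mem_orthogonal_singleton_iff_inner_right]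
      simp only [vsub_eq_sub, inner_sub_right, hx.2, hy.2, sub_self]
    intro x hx
    exact Submodule.mem_orthogonal_singleton_iff_inner_left.1 (h1 hx)

theorem isFacet_unitRay (hconv : Convex ℝ P) (hcomp : IsCompact P)
    (hfin : (vertices P).Finite) {v u : EuclideanSpace ℝ (Fin n)}
    (hv : v ∈ P) (hu : u ∈ unitRays (normalCone P v)) :
    IsFacet P {x ∈ P | ⟪u, x⟫ = ⟪u, v⟫} := by
  have huN : u ∈ normalCone P v := hu.2.subset ⟨1, zero_le_one, by simp⟩
  constructor
  · intro _
    refine ⟨innerSL ℝ u, ?_⟩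
    ext x
    simp only [Set.mem_ofPred_eq, innerSL_apply_apply]
    constructor
    · rintro ⟨hx, h⟩
      exact ⟨hx, fun y hy => by rw [h]; exact huN y hy⟩
    · rintro ⟨hx, h⟩
      exact ⟨hx, le_antisymm (huN x hx) (h v hv)⟩
  · have h1 := Submodule.finrank_add_finrank_orthogonal
      (vectorSpan ℝ {x ∈ P | ⟪u, x⟫ = ⟪u, v⟫})
    have hu0 : u ≠ 0 := by
      rw [← norm_ne_zero_iff, hu.1]
      exact one_ne_zero
    rwa [orthogonal_vectorSpan_unitRay hconv hcomp hfin hv hu, finrank_span_singleton hu0,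
      finrank_euclideanSpace_fin] at h1

/-- Different unit rays of the normal cone at `v` belong to different facets of `P` at `v`. -/
theorem encard_unitRays_le (hconv : Convex ℝ P) (hcomp : IsCompact P)
    (hfin : (vertices P).Finite) (hfull : (interior P).Nonempty) {v : EuclideanSpace ℝ (Fin n)}
    (hv : v ∈ P) :
    (unitRays (normalCone P v)).encard ≤ {F | IsFacet P F ∧ v ∈ F}.encard := by
  refine Set.encard_le_encard_of_injOn (f := fun u => {x ∈ P | ⟪u, x⟫ = ⟪u, v⟫})
    (fun u hu => ⟨isFacet_unitRay hconv hcomp hfin hv hu, hv, rfl⟩) ?_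
  intro u hu u' hu' h
  simp only at h
  have h1 : u' ∈ ℝ ∙ u := by
    rw [← orthogonal_vectorSpan_unitRay hconv hcomp hfin hv hu, h,
      orthogonal_vectorSpan_unitRay hconv hcomp hfin hv hu']
    exact Submodule.mem_span_singleton_self u'
  obtain ⟨s, rfl⟩ := Submodule.mem_span_singleton.1 h1
  have hs : |s| = 1 := by
    have := hu'.1
    rwa [norm_smul, hu.1, mul_one, Real.norm_eq_abs] at this
  rcases (abs_eq zero_le_one).1 hs with rfl | rfl
  · simp
  · exfalso
    have huN : u ∈ normalCone P v := hu.2.subset ⟨1, zero_le_one, by simp⟩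
    have huN' : (-1 : ℝ) • u ∈ normalCone P v := hu'.2.subset ⟨1, zero_le_one, by simp⟩
    obtain ⟨x₀, hx₀⟩ := hfull
    obtain ⟨ρ, hρ, hball⟩ :=
      Metric.nhds_basis_closedBall.mem_iff.1 (mem_interior_iff_mem_nhds.1 hx₀)
    have h2 := mul_norm_le_inner_of_mem_normalCone hρ.le hball huN
    have h3 := mul_norm_le_inner_of_mem_normalCone hρ.le hball huN'
    rw [hu'.1, real_inner_smul_left] at h3
    rw [hu.1] at h2
    linarith

/-- The normal cones of a simple polytope are simplicial: at a vertex there are at most `n` unit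
rays, as each one belongs to a facet of its own, and they span the space. -/
theorem exists_basis_normalCone (hconv : Convex ℝ P) (hcomp : IsCompact P)
    (hfin : (vertices P).Finite) (hfull : (interior P).Nonempty) (hsimple : IsSimplePolytope P)
    {v : EuclideanSpace ℝ (Fin n)} (hv : v ∈ vertices P) :
    ∃ r : Module.Basis (Fin n) ℝ (EuclideanSpace ℝ (Fin n)),
      Set.range r = unitRays (normalCone P v) ∧
        ∀ c, c ∈ normalCone P v ↔ ∀ i, 0 ≤ r.coord i c := by
  set R := unitRays (normalCone P v) with hR
  have hle : R.encard ≤ n := by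
    rw [← hsimple v hv]
    exact encard_unitRays_le hconv hcomp hfin hfull hv.1
  have hRfin : R.Finite := Set.finite_of_encard_le_coe hle
  have hspan : Submodule.span ℝ R = ⊤ := span_unitRays_normalCone hconv hcomp hfin hfull hv
  have : Fintype R := hRfin.fintype
  have hcard : Fintype.card R = n := by
    apply le_antisymm
    · rw [← hRfin.cast_ncard_eq] at hle
      rw [← Nat.card_eq_fintype_card]
      exact_mod_cast hle
    · have h1 := finrank_range_le_card (R := ℝ) (fun u : R => (u : EuclideanSpace ℝ (Fin n)))
      rw [Set.finrank, Subtype.range_coe, hspan, finrank_top, finrank_euclideanSpace_fin] at h1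
      exact h1
  have e : Fin n ≃ R := (finCongr hcard.symm).trans (Fintype.equivFin R).symm
  have hrange : Set.range (fun i => (e i : EuclideanSpace ℝ (Fin n))) = R := by
    rw [show (fun i => (e i : EuclideanSpace ℝ (Fin n))) = Subtype.val ∘ e from rfl,
      e.surjective.range_comp, Subtype.range_coe]
  let r := basisOfTopLeSpanOfCardEqFinrank (R := ℝ)
    (fun i => (e i : EuclideanSpace ℝ (Fin n))) (by rw [hrange, hspan])
    (by simp)
  have hr : ⇑r = fun i => (e i : EuclideanSpace ℝ (Fin n)) :=
    coe_basisOfTopLeSpanOfCardEqFinrank _ _ _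
  have hrr : Set.range r = R := by rw [hr, hrange]
  refine ⟨r, hrr, fun c => ⟨fun hc i => ?_, fun hc => ?_⟩⟩
  · set w := (InnerProductSpace.toDual ℝ (EuclideanSpace ℝ (Fin n))).symm
      (LinearMap.toContinuousLinearMap (r.coord i)) with hw
    have hwi : ∀ x, ⟪w, x⟫ = r.coord i x := fun x => by
      rw [hw, InnerProductSpace.toDual_symm_apply]
      rfl
    rw [← hwi]
    refine inner_nonneg_of_mem_normalCone hfull (fun u hu => ?_) hc
    rw [← hR, ← hrr] at hu
    obtain ⟨j, rfl⟩ := hu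
    rw [hwi, Module.Basis.coord_apply, Module.Basis.repr_self, Finsupp.single_apply]
    split_ifs <;> norm_num
  · intro x hx
    rw [← r.sum_repr c, sum_inner, sum_inner]
    refine Finset.sum_le_sum fun i _ => ?_
    have hri : r i ∈ normalCone P v := by
      have h1 : r i ∈ R := hrr ▸ Set.mem_range_self i
      exact h1.2.subset ⟨1, zero_le_one, by simp⟩
    exact smul_mem_normalCone hri (hc i) x hx

end NormalCone

/-! ### The parameter `δ` -/

/-- The unit normal `z` of the hyperplane `r.coord i = 0`, on the side of `r i`. Its value at `r i`
is the distance of `r i` from the span of the other basis vectors; only one inequality is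
needed. -/
theorem exists_unit_normal_infDist_le {n : ℕ}
    (r : Module.Basis (Fin n) ℝ (EuclideanSpace ℝ (Fin n))) (i : Fin n) :
    ∃ z : EuclideanSpace ℝ (Fin n), ‖z‖ = 1 ∧ 0 < ⟪z, r i⟫ ∧
      (∀ x, ⟪z, x⟫ = ⟪z, r i⟫ * r.coord i x) ∧
      Metric.infDist (r i) (Submodule.span ℝ (Set.range r \ {r i}) :
        Set (EuclideanSpace ℝ (Fin n))) ≤ ⟪z, r i⟫ := by
  set w := (InnerProductSpace.toDual ℝ (EuclideanSpace ℝ (Fin n))).symm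
      (LinearMap.toContinuousLinearMap (r.coord i)) with hw
  have hwi : ∀ x, ⟪w, x⟫ = r.coord i x := fun x => by
    rw [hw, InnerProductSpace.toDual_symm_apply]
    rfl
  have hri : r.coord i (r i) = 1 := by simp
  have hw0 : w ≠ 0 := by
    intro h
    have := hwi (r i)
    rw [h, inner_zero_left, hri] at this
    exact zero_ne_one this
  have hn : 0 < ‖w‖ := norm_pos_iff.2 hw0
  have hz : ∀ x, ⟪‖w‖⁻¹ • w, x⟫ = ‖w‖⁻¹ * r.coord i x := fun x => by
    rw [real_inner_smul_left, hwi]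
  have hzr : ⟪‖w‖⁻¹ • w, r i⟫ = ‖w‖⁻¹ := by rw [hz, hri, mul_one]
  have hz1 : ‖‖w‖⁻¹ • w‖ = 1 := norm_smul_inv_norm hw0
  refine ⟨‖w‖⁻¹ • w, hz1, by rw [hzr]; positivity, fun x => by rw [hz, hzr], ?_⟩
  -- the foot of the perpendicular from `r i` to the hyperplane
  set y := r i - ‖w‖⁻¹ • (‖w‖⁻¹ • w) with hy
  have hyc : r.coord i y = 0 := by
    have h1 := hz y
    rw [hy, inner_sub_right, hzr, real_inner_smul_right, real_inner_self_eq_norm_sq, hz1] at h1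
    have h2 : ‖w‖⁻¹ * r.coord i y = 0 := by rw [hy, ← h1]; ring
    exact (mul_eq_zero.1 h2).resolve_left (by positivity)
  have hyS : y ∈ Submodule.span ℝ (Set.range r \ {r i}) := by
    have h1 : Set.range r \ {r i} = r '' {i}ᶜ := by
      rw [Set.image_compl_eq_range_sdiff_image r.injective, Set.image_singleton]
    rw [h1, Module.Basis.mem_span_image]
    intro j hj
    simp only [Set.mem_compl_iff, Set.mem_singleton_iff]
    rintro rfl
    exact (Finsupp.mem_support_iff.1 hj) hyc
  refine (Metric.infDist_le_dist_of_mem hyS).trans ?_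
  rw [dist_eq_norm, hy, sub_sub_cancel, norm_smul, hz1, hzr, mul_one]
  simp

section

variable {n : ℕ} {P : Set (EuclideanSpace ℝ (Fin n))}

/-- `δ` is positive because the unit rays of each normal cone are linearly independent and there are
only finitely many vertices. -/
theorem coneDelta_pos (hn : 0 < n) (hconv : Convex ℝ P) (hcomp : IsCompact P)
    (hfin : (vertices P).Finite) (hfull : (interior P).Nonempty) (hsimple : IsSimplePolytope P) :
    0 < coneDelta P := by
  have hfinite : (rayDistances P).Finite := by
    have h1 : rayDistances P ⊆ ⋃ v ∈ vertices P, (fun u => Metric.infDist u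
        (Submodule.span ℝ (unitRays (normalCone P v) \ {u}) : Set (EuclideanSpace ℝ (Fin n)))) ''
          unitRays (normalCone P v) := by
      rintro d ⟨v, hv, u, hu, rfl⟩
      exact Set.mem_biUnion hv ⟨u, hu, rfl⟩
    refine (hfin.biUnion fun v hv => Set.Finite.image _ ?_).subset h1
    obtain ⟨r, hr, -⟩ := exists_basis_normalCone hconv hcomp hfin hfull hsimple hv
    rw [← hr]
    exact Set.finite_range r
  have hne : (rayDistances P).Nonempty := by
    obtain ⟨v, hv⟩ := hcomp.extremePoints_nonempty (hfull.mono interior_subset)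
    obtain ⟨r, hr, -⟩ := exists_basis_normalCone hconv hcomp hfin hfull hsimple hv
    exact ⟨_, v, hv, r ⟨0, hn⟩, hr ▸ Set.mem_range_self _, rfl⟩
  obtain ⟨v, hv, u, hu, hd⟩ := hne.csInf_mem hfinite
  rw [coneDelta, hd]
  obtain ⟨r, hr, -⟩ := exists_basis_normalCone hconv hcomp hfin hfull hsimple hv
  rw [← hr] at hu ⊢
  obtain ⟨i, rfl⟩ := hu
  refine ((Submodule.closed_of_finiteDimensional _).notMem_iff_infDist_pos ⟨0, ?_⟩).1 ?_
  · exact Submodule.zero_mem _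
  · have h1 : Set.range r \ {r i} = r '' {i}ᶜ := by
      rw [Set.image_compl_eq_range_sdiff_image r.injective, Set.image_singleton]
    rw [h1, SetLike.mem_coe]
    exact r.linearIndependent.notMem_span_image (by simp)

theorem coneDelta_le {v u : EuclideanSpace ℝ (Fin n)} (hv : v ∈ vertices P)
    (hu : u ∈ unitRays (normalCone P v)) :
    coneDelta P ≤ Metric.infDist u
      (Submodule.span ℝ (unitRays (normalCone P v) \ {u}) : Set (EuclideanSpace ℝ (Fin n))) := by
  refine csInf_le ⟨0, ?_⟩ ⟨v, hv, u, hu, rfl⟩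
  rintro d ⟨_, _, _, _, rfl⟩
  exact Metric.infDist_nonneg

/-! ### Vertices of the shadow -/

/-- The pairs `(U, V)` in whose span there is a vector with `v` as its unique maximizer among the
vertices of `P`. Generically, these are the pairs for which `v` projects to a vertex of the
shadow. -/
def shadowVertexEvent (P : Set (EuclideanSpace ℝ (Fin n))) (v : EuclideanSpace ℝ (Fin n)) :
    Set (EuclideanSpace ℝ (Fin n) × EuclideanSpace ℝ (Fin n)) :=
  {p | ∃ s t : ℝ, ∀ x ∈ vertices P, x ≠ v → ⟪s • p.1 + t • p.2, x⟫ < ⟪s • p.1 + t • p.2, v⟫}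

theorem isOpen_shadowVertexEvent (hfin : (vertices P).Finite) (v : EuclideanSpace ℝ (Fin n)) :
    IsOpen (shadowVertexEvent P v) := by
  have : shadowVertexEvent P v = ⋃ s : ℝ, ⋃ t : ℝ, ⋂ x ∈ vertices P \ {v},
      {p | ⟪s • p.1 + t • p.2, x⟫ < ⟪s • p.1 + t • p.2, v⟫} := by
    ext p
    simp [shadowVertexEvent]
  rw [this]
  refine isOpen_iUnion fun s => isOpen_iUnion fun t => ?_
  exact (hfin.subset Set.sdiff_subset).isOpen_biInter fun x _ =>
    isOpen_lt (by fun_prop) (by fun_prop)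

/-- If no two vertices of `P` have the same projection, then the vertices of the shadow are the
projections of the vertices `v` for which `shadowVertexEvent P v` occurs. -/
theorem vertices_shadow_eq (hconv : Convex ℝ P) (hcomp : IsCompact P)
    (hfin : (vertices P).Finite) {p : EuclideanSpace ℝ (Fin n) × EuclideanSpace ℝ (Fin n)}
    (hinj : Set.InjOn (fun x => (⟪p.1, x⟫, ⟪p.2, x⟫)) (vertices P)) :
    vertices (shadow P p) = (fun x => (⟪p.1, x⟫, ⟪p.2, x⟫)) ''
      {v ∈ vertices P | p ∈ shadowVertexEvent P v} := by
  set f : EuclideanSpace ℝ (Fin n) →ₗ[ℝ] ℝ × ℝ :=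
    ((innerₗ (EuclideanSpace ℝ (Fin n)) p.1).prod (innerₗ (EuclideanSpace ℝ (Fin n)) p.2)) with hf
  have hfx : ∀ x, f x = (⟪p.1, x⟫, ⟪p.2, x⟫) := fun x => rfl
  have hshadow : shadow P p = convexHull ℝ (f '' vertices P) := by
    rw [← LinearMap.image_convexHull, convexHull_vertices hconv hcomp hfin]
    rfl
  change Set.InjOn f (vertices P) at hinj
  change vertices (shadow P p) = f '' _
  ext y
  constructor
  · intro hy
    rw [vertices, hshadow] at hy
    obtain ⟨v, hv, rfl⟩ := extremePoints_convexHull_subset hy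
    obtain ⟨g, hg⟩ := exists_lt_of_mem_extremePoints_convexHull (hfin.image f) hy
    refine ⟨v, ⟨hv, g (1, 0), g (0, 1), fun x hx hxv => ?_⟩, rfl⟩
    have hgx : ∀ x, g (f x) = ⟪g (1, 0) • p.1 + g (0, 1) • p.2, x⟫ := by
      intro x
      have h1 : f x = ⟪p.1, x⟫ • (1, 0) + ⟪p.2, x⟫ • (0, 1) := by simp [hfx]
      rw [h1, map_add, map_smul, map_smul, inner_add_left, real_inner_smul_left,
        real_inner_smul_left, smul_eq_mul, smul_eq_mul]
      ring
    rw [← hgx, ← hgx]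
    exact hg _ ⟨x, hx, rfl⟩ fun h => hxv (hinj hx hv h)
  · rintro ⟨v, ⟨hv, s, t, hst⟩, rfl⟩
    have hcN : s • p.1 + t • p.2 ∈ normalCone P v :=
      (mem_normalCone_iff_vertices hconv hcomp hfin).2 fun x hx => by
        rcases eq_or_ne x v with rfl | h
        · rfl
        · exact (hst x hx h).le
    -- a vertex of the face of the shadow exposed by `(s, t)` is the image of a vertex of `P`
    set l : StrongDual ℝ (ℝ × ℝ) :=
      s • ContinuousLinearMap.fst ℝ ℝ ℝ + t • ContinuousLinearMap.snd ℝ ℝ ℝ with hl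
    have hlx : ∀ x, l (f x) = ⟪s • p.1 + t • p.2, x⟫ := by
      intro x
      simp [hl, hfx, inner_add_left, real_inner_smul_left]
    have hexp : IsExposed ℝ (shadow P p) {y ∈ shadow P p | ∀ y' ∈ shadow P p, l y' ≤ l y} :=
      fun _ => ⟨l, rfl⟩
    have hfv : f v ∈ {y ∈ shadow P p | ∀ y' ∈ shadow P p, l y' ≤ l y} := by
      refine ⟨⟨v, hv.1, rfl⟩, ?_⟩
      rintro _ ⟨x, hx, rfl⟩
      change l (f x) ≤ l (f v)
      rw [hlx, hlx]
      exact hcN x hx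
    have hcompS : IsCompact (shadow P p) := by
      rw [hshadow]
      exact (hfin.image f).isCompact_convexHull ℝ
    obtain ⟨y, hy⟩ := (hexp.isCompact hcompS).extremePoints_nonempty ⟨_, hfv⟩
    have hy2 := hexp.isExtreme.extremePoints_subset_extremePoints hy
    have hy3 : y ∈ f '' vertices P := by
      rw [hshadow] at hy2
      exact extremePoints_convexHull_subset hy2
    obtain ⟨x, hx, rfl⟩ := hy3
    have hxv : x = v := by
      by_contra h
      have h1 := hst x hx h
      have h2 := hy.1.2 _ hfv.1
      rw [hlx, hlx] at h2
      linarith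
    rw [← hxv]
    exact hy2

/-- As the events are open, this shows that `shadowSize P` is almost everywhere equal to a
measurable function. -/
theorem shadowSize_eq_sum_indicator (hconv : Convex ℝ P) (hcomp : IsCompact P)
    (hfin : (vertices P).Finite) {p : EuclideanSpace ℝ (Fin n) × EuclideanSpace ℝ (Fin n)}
    (hinj : Set.InjOn (fun x => (⟪p.1, x⟫, ⟪p.2, x⟫)) (vertices P)) :
    (shadowSize P p : ℝ) =
      ∑ v ∈ hfin.toFinset, (shadowVertexEvent P v).indicator (fun _ => (1 : ℝ)) p := by
  classical
  have hsub : {v ∈ vertices P | p ∈ shadowVertexEvent P v} ⊆ vertices P := Set.sep_subset _ _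
  rw [shadowSize, vertices_shadow_eq hconv hcomp hfin hinj,
    (hinj.mono hsub).ncard_image]
  have h1 : {v ∈ vertices P | p ∈ shadowVertexEvent P v} =
      ((hfin.toFinset.filter fun v => p ∈ shadowVertexEvent P v : Finset _) : Set _) := by
    ext v
    simp
  rw [h1, Set.ncard_coe_finset, Finset.card_filter]
  push_cast
  rfl

end

/-! ### Intersecting a random plane with a simplicial cone -/

/-- If nonnegative coordinates `f` are moved in a direction `g` with a negative entry, there is a
moment at which they are still nonnegative and one of them vanishes. -/
theorem exists_first_zero {ι : Type*} [Fintype ι] {f g : ι → ℝ} (hf : ∀ i, 0 ≤ f i)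
    (hg : ∃ i, g i < 0) : ∃ τ : ℝ, (∀ i, 0 ≤ f i + τ * g i) ∧ ∃ i, f i + τ * g i = 0 := by
  classical
  obtain ⟨j, hj⟩ := hg
  obtain ⟨i, hi, hmin⟩ := Finset.exists_min_image (Finset.univ.filter fun i => g i < 0)
    (fun i => f i / (-g i)) ⟨j, by simpa using hj⟩
  simp only [Finset.mem_filter, Finset.mem_univ, true_and] at hi hmin
  refine ⟨f i / (-g i), fun k => ?_, i, by field_simp [hi.ne]; ring⟩
  have hτ : 0 ≤ f i / (-g i) := div_nonneg (hf i) (by linarith)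
  rcases lt_or_ge (g k) 0 with hk | hk
  · have h1 := hmin k hk
    rw [le_div_iff₀ (by linarith)] at h1
    linarith
  · have := hf k
    positivity

/-- A plane with orthonormal basis `U, V` that contains a nonzero vector of a simplicial cone
intersects the boundary of the cone: for one of the facets, the line in which the plane meets the
hyperplane of the facet contains a point of the cone. -/
theorem exists_facet_of_plane {n : ℕ} (r : Module.Basis (Fin n) ℝ (EuclideanSpace ℝ (Fin n)))
    {U V : EuclideanSpace ℝ (Fin n)} (hU : ‖U‖ = 1) (hV : ‖V‖ = 1) (hUV : ⟪U, V⟫ = 0)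
    (hrU : ∀ i, r.coord i U ≠ 0) {s t : ℝ} (hst : s • U + t • V ≠ 0)
    (hc : ∀ i, 0 ≤ r.coord i (s • U + t • V)) :
    ∃ i, (∀ j, 0 ≤ r.coord j (r.coord i V • U - r.coord i U • V)) ∨
      (∀ j, 0 ≤ r.coord j (r.coord i U • V - r.coord i V • U)) := by
  have hzero : ∀ α β : ℝ, α • U + β • V = 0 → α = 0 ∧ β = 0 := by
    intro α β h
    have h1 := congrArg (fun x => ⟪U, x⟫) h
    have h2 := congrArg (fun x => ⟪V, x⟫) h
    simp only [inner_add_right, real_inner_smul_right, real_inner_self_eq_norm_sq, hU, hV, hUV,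
      real_inner_comm U V, inner_zero_right] at h1 h2
    constructor <;> linarith
  have hst2 : 0 < s ^ 2 + t ^ 2 := by
    by_contra h
    have hs : s = 0 := by nlinarith [sq_nonneg s, sq_nonneg t]
    have ht : t = 0 := by nlinarith [sq_nonneg s, sq_nonneg t]
    exact hst (by simp [hs, ht])
  -- a direction of the plane, independent of the given vector, in which the cone is left
  have hdir : ∃ σ : ℝ, ∃ i, r.coord i ((-σ * t) • U + (σ * s) • V) < 0 := by
    have hd : (-t) • U + s • V ≠ 0 := by
      intro h
      obtain ⟨h1, h2⟩ := hzero _ _ h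
      rw [neg_eq_zero] at h1
      rw [h1, h2] at hst2
      norm_num at hst2
    obtain ⟨i, hi⟩ : ∃ i, r.coord i ((-t) • U + s • V) ≠ 0 := by
      by_contra! h
      exact hd (r.forall_coord_eq_zero_iff.1 h)
    rcases lt_or_gt_of_ne hi with h | h
    · exact ⟨1, i, by simpa using h⟩
    · refine ⟨-1, i, ?_⟩
      have : (-(-1 : ℝ) * t) • U + (-1 * s) • V = -((-t) • U + s • V) := by module
      rw [this, map_neg]
      linarith
  obtain ⟨σ, hσ⟩ := hdir
  -- the first point on the boundary of the cone is a multiple of the vector in the statement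
  obtain ⟨τ, hτ, i, hi⟩ := exists_first_zero hc hσ
  set α := s + τ * (-σ * t) with hα
  set β := t + τ * (σ * s) with hβ
  have hcomb : ∀ j, r.coord j (s • U + t • V) + τ * r.coord j ((-σ * t) • U + (σ * s) • V) =
      r.coord j (α • U + β • V) := by
    intro j
    rw [← smul_eq_mul, ← map_smul, ← map_add]
    congr 1
    module
  simp_rw [hcomb] at hτ hi
  have hαβ : β ≠ 0 := by
    intro h0
    have h1 : α = 0 := by
      rw [h0, zero_smul, add_zero, map_smul, smul_eq_mul] at hi
      exact (mul_eq_zero.1 hi).resolve_right (hrU i)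
    have h2 : (s ^ 2 + t ^ 2) * (1 + (τ * σ) ^ 2) = α ^ 2 + β ^ 2 := by
      rw [hα, hβ]
      ring
    rw [h0, h1] at h2
    have : 0 < (s ^ 2 + t ^ 2) * (1 + (τ * σ) ^ 2) := by positivity
    rw [h2] at this
    norm_num at this
  have hD : β • (r.coord i U • V - r.coord i V • U) = r.coord i U • (α • U + β • V) := by
    have h1 : r.coord i U * α = -(β * r.coord i V) := by
      rw [map_add, map_smul, map_smul, smul_eq_mul, smul_eq_mul] at hi
      linarith
    rw [smul_add, smul_smul, h1]
    module
  refine ⟨i, ?_⟩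
  have hD' : ∀ j, β * r.coord j (r.coord i U • V - r.coord i V • U) =
      r.coord i U * r.coord j (α • U + β • V) := fun j => by
    rw [← smul_eq_mul, ← map_smul, hD, map_smul, smul_eq_mul]
  have hD2 : ∀ j, r.coord j (r.coord i U • V - r.coord i V • U) =
      (r.coord i U / β) * r.coord j (α • U + β • V) := fun j => by
    rw [div_mul_eq_mul_div, eq_div_iff hαβ, mul_comm, hD']
  rcases le_total 0 (r.coord i U / β) with h | h
  · right
    intro j
    rw [hD2]
    exact mul_nonneg h (hτ j)
  · left
    intro j
    rw [← neg_sub, map_neg, hD2, ← neg_mul]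
    exact mul_nonneg (by linarith) (hτ j)

section

variable {n : ℕ}

theorem ae_uniformFrame_inner_fst_ne_zero {z : EuclideanSpace ℝ (Fin n)} (hz : z ≠ 0) :
    ∀ᵐ p ∂(uniformFrame n), ⟪z, p.1⟫ ≠ 0 := by
  unfold uniformFrame
  have hs : MeasurableSet {p : EuclideanSpace ℝ (Fin n) × EuclideanSpace ℝ (Fin n) |
      ⟪z, p.1⟫ ≠ 0} := (measurableSet_eq_fun (by fun_prop) (by fun_prop)).compl
  rw [ae_map_iff (measurable_orthonormalize n).aemeasurable hs]
  have h1 : ∀ᵐ x ∂(stdGaussian (EuclideanSpace ℝ (Fin n))), ⟪z, x⟫ ≠ 0 := by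
    refine measure_mono_null ?_ (stdGaussian_hyperplane z hz)
    intro x hx
    simpa using hx
  have h2 := Measure.quasiMeasurePreserving_fst
    (μ := stdGaussian (EuclideanSpace ℝ (Fin n))) (ν := stdGaussian (EuclideanSpace ℝ (Fin n)))
    |>.ae h1
  filter_upwards [h2] with p hp
  have hp1 : p.1 ≠ 0 := by
    intro h
    rw [h, inner_zero_right] at hp
    exact hp rfl
  simp only [orthonormalize]
  rw [real_inner_smul_right]
  exact mul_ne_zero (inv_ne_zero (norm_ne_zero_iff.2 hp1)) hp

/-- Orthonormalization does not change the line in which the plane of a pair meets a hyperplane. -/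
theorem uniformFrame_mem_cone_le (hn : 2 ≤ n) (z : EuclideanSpace ℝ (Fin n))
    {S : Set (EuclideanSpace ℝ (Fin n))} (hS : MeasurableSet S)
    (hcone : ∀ t : ℝ, 0 < t → ∀ x ∈ S, t • x ∈ S) :
    uniformFrame n {p | ⟪z, p.2⟫ • p.1 - ⟪z, p.1⟫ • p.2 ∈ S} ≤
      ((stdGaussian (EuclideanSpace ℝ (Fin n))).prod (stdGaussian (EuclideanSpace ℝ (Fin n))))
        {p | ⟪z, p.2⟫ • p.1 - ⟪z, p.1⟫ • p.2 ∈ S} := by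
  have hm : Measurable fun p : EuclideanSpace ℝ (Fin n) × EuclideanSpace ℝ (Fin n) =>
    ⟪z, p.2⟫ • p.1 - ⟪z, p.1⟫ • p.2 := by fun_prop
  have hmS : MeasurableSet {p : EuclideanSpace ℝ (Fin n) × EuclideanSpace ℝ (Fin n) |
    ⟪z, p.2⟫ • p.1 - ⟪z, p.1⟫ • p.2 ∈ S} := hm hS
  have horth := uniformFrame_orthonormal hn
  unfold uniformFrame at horth ⊢
  rw [Measure.map_apply (measurable_orthonormalize n) hmS]
  refine measure_mono_ae ?_
  filter_upwards [ae_of_ae_map (measurable_orthonormalize n).aemeasurable horth] with p hp hpS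
  obtain ⟨h1, h2, -⟩ := hp
  change ⟪z, (orthonormalize p).2⟫ • (orthonormalize p).1 -
    ⟪z, (orthonormalize p).1⟫ • (orthonormalize p).2 ∈ S at hpS
  change ⟪z, p.2⟫ • p.1 - ⟪z, p.1⟫ • p.2 ∈ S
  simp only [orthonormalize] at h1 h2 hpS
  set U := ‖p.1‖⁻¹ • p.1 with hU
  set W := p.2 - ⟪U, p.2⟫ • U with hW
  have hp1 : 0 < ‖p.1‖ := by
    rw [norm_pos_iff]
    intro h
    rw [hU, h, smul_zero, norm_zero] at h1
    exact zero_ne_one h1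
  have hW1 : 0 < ‖W‖ := by
    rw [norm_pos_iff]
    intro h
    rw [h, smul_zero, norm_zero] at h2
    exact zero_ne_one h2
  have key : ⟪z, ‖W‖⁻¹ • W⟫ • U - ⟪z, U⟫ • (‖W‖⁻¹ • W) =
      (‖W‖⁻¹ * ‖p.1‖⁻¹) • (⟪z, p.2⟫ • p.1 - ⟪z, p.1⟫ • p.2) := by
    rw [real_inner_smul_right, hW, inner_sub_right, real_inner_smul_right, hU,
      real_inner_smul_right]
    module
  rw [key] at hpS
  have h3 := hcone (‖W‖⁻¹ * ‖p.1‖⁻¹)⁻¹ (by positivity) _ hpS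
  rwa [smul_smul, inv_mul_cancel₀ (by positivity), one_smul] at h3

variable {P : Set (EuclideanSpace ℝ (Fin n))}

/-- If `v` projects to a vertex of the shadow, then the random plane meets the boundary of the normal
cone at `v` in one of its `n` facets. The line in which the plane meets the hyperplane of the facet
has two directions, and each of them is in the facet with probability at most `O(n / δ)` times the
Gaussian measure of the normal cone. -/
theorem uniformFrame_shadowVertexEvent_le (hn : 2 ≤ n) (hconv : Convex ℝ P) (hcomp : IsCompact P)
    (hfin : (vertices P).Finite) (hfull : (interior P).Nonempty) (hsimple : IsSimplePolytope P)
    {v : EuclideanSpace ℝ (Fin n)} (hv : v ∈ vertices P) :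
    uniformFrame n (shadowVertexEvent P v) ≤
      ENNReal.ofReal (2 * (Real.exp 1 * (gaussianPDFReal 0 1 1)⁻¹) * (n ^ 2 / coneDelta P)) *
        stdGaussian (EuclideanSpace ℝ (Fin n)) (normalCone P v) := by
  have hδ : 0 < coneDelta P := coneDelta_pos (by omega) hconv hcomp hfin hfull hsimple
  obtain ⟨r, hr, hrN⟩ := exists_basis_normalCone hconv hcomp hfin hfull hsimple hv
  choose z hz1 hz2 hz3 hz4 using fun i => exists_unit_normal_infDist_le r i
  set N := normalCone P v with hN
  have hNm : MeasurableSet N := (isClosed_normalCone v).measurableSet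
  have hNcone : ∀ t : ℝ, 0 < t → ∀ x ∈ N, t • x ∈ N := fun t ht x hx =>
    smul_mem_normalCone hx ht.le
  set K : ℝ := Real.exp 1 * (gaussianPDFReal 0 1 1)⁻¹ with hK
  have hK0 : 0 ≤ K := mul_nonneg (Real.exp_pos 1).le (inv_nonneg.2 (gaussianPDFReal_nonneg _ _ _))
  set γ := stdGaussian (EuclideanSpace ℝ (Fin n)) with hγ
  set D : Fin n → EuclideanSpace ℝ (Fin n) × EuclideanSpace ℝ (Fin n) → EuclideanSpace ℝ (Fin n) :=
    fun i p => ⟪z i, p.2⟫ • p.1 - ⟪z i, p.1⟫ • p.2 with hD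
  have hbound : ∀ i, (γ.prod γ) {p | D i p ∈ N} ≤
      ENNReal.ofReal (K * (n / coneDelta P)) * γ N := by
    intro i
    have hriR : r i ∈ unitRays N := hr ▸ Set.mem_range_self i
    have hriN : r i ∈ N := hriR.2.subset ⟨1, zero_le_one, by simp⟩
    have h1 := stdGaussian_prod_plane_inter_hyperplane_mem_cone_le (hz1 i) hNm hNcone
    have h2 := stdGaussian_facet_le_cone (C := N) (hz1 i) hriR.1 (hz2 i)
      (by rwa [finrank_euclideanSpace_fin]) hNm hNm hNcone fun x hx _ t ht => by
        -- `x + t • r i` is the midpoint of `2 • x` and `(2 * t) • r i`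
        have := convex_normalCone v (smul_mem_normalCone hx (t := 2) (by norm_num))
          (smul_mem_normalCone hriN (t := 2 * t) (by positivity))
          (a := 1 / 2) (b := 1 / 2) (by norm_num) (by norm_num) (by norm_num)
        convert this using 1
        module
    refine (h1.trans h2).trans ?_
    rw [finrank_euclideanSpace_fin]
    gcongr
    refine (coneDelta_le hv hriR).trans ?_
    have := hz4 i
    rwa [hr] at this
  -- exchanging the two Gaussian vectors reverses the sign of `D i`
  have hneg : ∀ i, (γ.prod γ) {p | -D i p ∈ N} = (γ.prod γ) {p | D i p ∈ N} := by
    intro i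
    have hm : Measurable (D i) := by fun_prop
    have hmN : MeasurableSet {p | D i p ∈ N} := hm hNm
    have h1 := Measure.prod_swap (μ := γ) (ν := γ)
    conv_rhs => rw [← h1, Measure.map_apply measurable_swap hmN]
    congr 1
    ext p
    simp [hD]
  have huF : ∀ i, uniformFrame n {p | D i p ∈ N} ≤ (γ.prod γ) {p | D i p ∈ N} := fun i =>
    uniformFrame_mem_cone_le hn (z i) hNm hNcone
  have huFneg : ∀ i, uniformFrame n {p | -D i p ∈ N} ≤ (γ.prod γ) {p | -D i p ∈ N} := fun i =>
    uniformFrame_mem_cone_le hn (z i) (S := {x | -x ∈ N}) (measurable_neg hNm)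
      fun t ht x hx => by
        have := hNcone t ht _ hx
        rwa [smul_neg] at this
  have hcover : uniformFrame n (shadowVertexEvent P v) ≤
      uniformFrame n (⋃ i, ({p | D i p ∈ N} ∪ {p | -D i p ∈ N})) := by
    refine measure_mono_ae ?_
    have hne : ∀ᵐ p ∂(uniformFrame n), ∀ i, ⟪z i, p.1⟫ ≠ 0 :=
      ae_all_iff.2 fun i => ae_uniformFrame_inner_fst_ne_zero
        (by rw [← norm_ne_zero_iff, hz1]; exact one_ne_zero)
    filter_upwards [uniformFrame_orthonormal hn, hne] with p hp hpz hpT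
    obtain ⟨s, t, hst⟩ := hpT
    obtain ⟨hU, hV, hUV⟩ := hp
    have hcN : s • p.1 + t • p.2 ∈ N :=
      (mem_normalCone_iff_vertices hconv hcomp hfin).2 fun x hx => by
        rcases eq_or_ne x v with rfl | h
        · rfl
        · exact (hst x hx h).le
    have hc0 : s • p.1 + t • p.2 ≠ 0 := by
      intro h0
      -- `v` would be the only vertex, and the normal cone the whole space
      have hall : -r ⟨0, by omega⟩ ∈ N :=
        (mem_normalCone_iff_vertices hconv hcomp hfin).2 fun x hx => by
          rcases eq_or_ne x v with rfl | h
          · rfl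
          · have := hst x hx h
            simp [h0] at this
      have h1 := (hrN _).1 hall ⟨0, by omega⟩
      rw [map_neg, Module.Basis.coord_apply, Module.Basis.repr_self, Finsupp.single_eq_same] at h1
      linarith
    have hcoordU : ∀ i, r.coord i p.1 ≠ 0 := by
      intro i h0
      have := hz3 i p.1
      rw [h0, mul_zero] at this
      exact hpz i this
    have hDi : ∀ i, D i p =
        ⟪z i, r i⟫ • (r.coord i p.2 • p.1 - r.coord i p.1 • p.2) := by
      intro i
      simp only [hD]
      rw [hz3 i p.2, hz3 i p.1]
      module
    obtain ⟨i, hi | hi⟩ := exists_facet_of_plane r hU hV hUV hcoordU hc0 ((hrN _).1 hcN)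
    · refine Set.mem_iUnion.2 ⟨i, Or.inl ?_⟩
      change D i p ∈ N
      rw [hDi]
      exact hNcone _ (hz2 i) _ ((hrN _).2 hi)
    · refine Set.mem_iUnion.2 ⟨i, Or.inr ?_⟩
      change -D i p ∈ N
      rw [hDi, ← smul_neg, neg_sub]
      exact hNcone _ (hz2 i) _ ((hrN _).2 hi)
  calc uniformFrame n (shadowVertexEvent P v)
      ≤ ∑ i, uniformFrame n ({p | D i p ∈ N} ∪ {p | -D i p ∈ N}) :=
        hcover.trans (measure_iUnion_fintype_le _ _)
    _ ≤ ∑ _i : Fin n, 2 * (ENNReal.ofReal (K * (n / coneDelta P)) * γ N) := by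
        refine Finset.sum_le_sum fun i _ => ?_
        rw [two_mul]
        refine (measure_union_le _ _).trans (add_le_add ?_ ?_)
        · exact (huF i).trans (hbound i)
        · exact (huFneg i).trans ((hneg i).le.trans (hbound i))
    _ = ENNReal.ofReal (2 * K * (n ^ 2 / coneDelta P)) * γ N := by
        rw [Finset.sum_const, Finset.card_univ, Fintype.card_fin, nsmul_eq_mul, ← mul_assoc,
          ← mul_assoc]
        congr 1
        have h2 : (2 : ENNReal) = ENNReal.ofReal 2 := by simp
        rw [h2, ← ENNReal.ofReal_natCast, ← ENNReal.ofReal_mul (by positivity),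
          ← ENNReal.ofReal_mul (by positivity)]
        congr 1
        ring

/-- The normal cones at different vertices overlap only in a hyperplane. -/
theorem sum_stdGaussian_normalCone_le_one (hfin : (vertices P).Finite) :
    ∑ v ∈ hfin.toFinset, stdGaussian (EuclideanSpace ℝ (Fin n)) (normalCone P v) ≤ 1 := by
  rw [← measure_univ (μ := stdGaussian (EuclideanSpace ℝ (Fin n)))]
  refine sum_measure_le_measure_univ
    (fun v _ => (isClosed_normalCone v).measurableSet.nullMeasurableSet) ?_
  intro v hv w hw hvw
  rw [SetLike.mem_coe, Set.Finite.mem_toFinset] at hv hw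
  refine measure_mono_null ?_ (stdGaussian_hyperplane (v - w) (sub_ne_zero.2 hvw))
  rintro c ⟨hcv, hcw⟩
  have h1 := hcv w hw.1
  have h2 := hcw v hv.1
  change ⟪v - w, c⟫ = 0
  rw [real_inner_comm, inner_sub_right]
  linarith

end

theorem mainTheorem3 :
    ∃ C : ℝ, 0 < C ∧ ∀ (n m : ℕ) (A : Matrix (Fin m) (Fin n) ℝ) (b : Fin m → ℝ),
      2 ≤ n →
      Bornology.IsBounded (polyhedron A b) →
      affineSpan ℝ (polyhedron A b) = ⊤ →
      IsSimplePolytope (polyhedron A b) →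
      MeasureTheory.Integrable (fun p => (shadowSize (polyhedron A b) p : ℝ)) (uniformFrame n) ∧
      ∫ p, (shadowSize (polyhedron A b) p : ℝ) ∂(uniformFrame n) ≤
        C * ((n : ℝ) ^ 2 / coneDelta (polyhedron A b)) := by
  have hφ : 0 < gaussianPDFReal 0 1 1 := gaussianPDFReal_pos _ _ _ one_ne_zero
  refine ⟨2 * (Real.exp 1 * (gaussianPDFReal 0 1 1)⁻¹), by positivity, ?_⟩
  intro n m A b hn hbdd hspan hsimple
  set P := polyhedron A b with hP
  have hconv : Convex ℝ P := convex_polyhedron A b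
  have hcomp : IsCompact P := Metric.isCompact_of_isClosed_isBounded (isClosed_polyhedron A b) hbdd
  have hfin : (vertices P).Finite := finite_vertices_polyhedron A b
  have hfull : (interior P).Nonempty := hconv.interior_nonempty_iff_affineSpan_eq_top.2 hspan
  have hδ : 0 < coneDelta P := coneDelta_pos (by omega) hconv hcomp hfin hfull hsimple
  have hinj : ∀ᵐ p ∂(uniformFrame n),
      Set.InjOn (fun x => (⟪p.1, x⟫, ⟪p.2, x⟫)) (vertices P) := by
    have h1 : ∀ᵐ p ∂(uniformFrame n), ∀ x ∈ vertices P, ∀ y ∈ vertices P, x ≠ y →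
        ⟪x - y, p.1⟫ ≠ 0 := by
      refine (ae_ball_iff hfin.countable).2 fun x _ => (ae_ball_iff hfin.countable).2 fun y _ => ?_
      by_cases hxy : x = y
      · exact Filter.Eventually.of_forall fun p h => absurd hxy h
      · filter_upwards [ae_uniformFrame_inner_fst_ne_zero (sub_ne_zero.2 hxy)] with p hp _
        exact hp
    filter_upwards [h1] with p hp x hx y hy hxy
    by_contra hne
    apply hp x hx y hy hne
    rw [real_inner_comm, inner_sub_right, sub_eq_zero]
    exact (Prod.ext_iff.1 hxy).1
  have hae : (fun p => (shadowSize P p : ℝ)) =ᵐ[uniformFrame n] fun p =>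
      ∑ v ∈ hfin.toFinset, (shadowVertexEvent P v).indicator (fun _ => (1 : ℝ)) p := by
    filter_upwards [hinj] with p hp
    exact shadowSize_eq_sum_indicator hconv hcomp hfin hp
  have hmeas : ∀ v, MeasurableSet (shadowVertexEvent P v) := fun v =>
    (isOpen_shadowVertexEvent hfin v).measurableSet
  have hint : ∀ v ∈ hfin.toFinset, Integrable
      (fun p => (shadowVertexEvent P v).indicator (fun _ => (1 : ℝ)) p) (uniformFrame n) :=
    fun v _ => (integrable_const 1).indicator (hmeas v)
  refine ⟨(integrable_finsetSum _ hint).congr hae.symm, ?_⟩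
  rw [integral_congr_ae hae, integral_finsetSum _ hint]
  have h1 : ∑ v ∈ hfin.toFinset,
      ∫ p, (shadowVertexEvent P v).indicator (fun _ => (1 : ℝ)) p ∂(uniformFrame n) =
      (∑ v ∈ hfin.toFinset, uniformFrame n (shadowVertexEvent P v)).toReal := by
    rw [ENNReal.toReal_sum fun v _ => measure_ne_top _ _]
    refine Finset.sum_congr rfl fun v _ => ?_
    rw [integral_indicator (hmeas v)]
    simp [Measure.real]
  rw [h1]
  refine ENNReal.toReal_le_of_le_ofReal (by positivity) ?_
  calc ∑ v ∈ hfin.toFinset, uniformFrame n (shadowVertexEvent P v)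
      ≤ ∑ v ∈ hfin.toFinset, ENNReal.ofReal
          (2 * (Real.exp 1 * (gaussianPDFReal 0 1 1)⁻¹) * (n ^ 2 / coneDelta P)) *
          stdGaussian (EuclideanSpace ℝ (Fin n)) (normalCone P v) :=
        Finset.sum_le_sum fun v hv => uniformFrame_shadowVertexEvent_le hn hconv hcomp hfin hfull
          hsimple (hfin.mem_toFinset.1 hv)
    _ ≤ _ := by
        rw [← Finset.mul_sum]
        exact mul_le_of_le_one_right zero_le (sum_stdGaussian_normalCone_le_one hfin)
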